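/- Let $\varphi:\mathbb{R}^d\to(-\infty,\infty]$ be proper, convex and lower semicontinuous with effective domain $\operatorname{dom}\varphi=\{x:\varphi(x)<\infty\}$, let $f:\mathbb{R}^d\to\mathbb{R}$ be differentiable, and put $\psi=f+\varphi$. Assume that $\psi(x)\ge\bar\psi$ for all $x\in\operatorname{dom}\varphi$ and some $\bar\psi\in\mathbb{R}$, and that $\nabla f:\mathbb{R}^d\to\mathbb{R}^d$ is Lipschitz continuous with modulus $L>0$ (for the Euclidean norm $\|\cdot\|$). For $\lambda>0$ let $$\operatorname{prox}_{\lambda\varphi}(x)=\operatorname*{argmin}_{y\in\mathbb{R}^d}\ \varphi(y)+\tfrac{1}{2\lambda}\|x-y\|^2,$$ and define the normal map and the natural residual $$F_{\rm nor}(z)=\nabla f(\operatorname{prox}_{\lambda\varphi}(z))+\tfrac1\lambda\bigl(z-\operatorname{prox}_{\lambda\varphi}(z)\bigr),\qquad F_{\rm nat}(x)=x-\operatorname{prox}_{\lambda\varphi}(x-\lambda\nabla f(x)).$$ Let $(\Omega,\mathcal F,\{\mathcal F_k\}_{k\ge0},\mathbb{P})$ be a filtered probability space, $z^0\in\mathbb{R}^d$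 a fixed (deterministic) point and $\alpha_k>0$, $k\ge 0$, step sizes. Let $g^k:\Omega\to\mathbb{R}^d$ be integrable and $\mathcal F_{k+1}$-measurable, and let the processes $\{z^k\}_k$ and $\{x^k\}_k$ be generated by $x^k=\operatorname{prox}_{\lambda\varphi}(z^k)$ and $$z^{k+1}=z^k-\alpha_k\Bigl(g^k+\tfrac1\lambda\bigl(z^k-\operatorname{prox}_{\lambda\varphi}(z^k)\bigr)\Bigr),\qquad k\ge0 .$$ Put $e^k=g^k-\nabla f(x^k)$ and assume: - $\sum_{k=0}^\infty\alpha_k=\infty$ and $\alpha_k\to0$; - $\mathbb{E}[g^k\mid\mathcal F_k]=\nabla f(x^k)$ almost surely for all $k$, and there are $A\ge0$ and $\{\sigma_k\}_k\subseteq[0,\infty)$ such that $\mathbb{E}[\|e^k\|^2\mid\mathcal F_k]\le\sigma_k^2+A(\psi(x^k)-\bar\psi)$ almost surely for all $k$; - $\sum_{k=0}^\infty\alpha_k^2\max\{A,\sigma_k^2\}<\infty$. Then every $x^k$ lies in $\operatorname{dom}\varphi$, and: (a) there is a random variable $\psi^*:\Omega\to\mathbb{R}$ such that, almost surely, $\|F_{\rm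 nor}(z^k)\|\to0$, $\|F_{\rm nat}(x^k)\|\to0$ and $\psi(x^k)\to\psi^*$ as $k\to\infty$; (b) the random variables $\|F_{\rm nor}(z^k)\|^2$, $\|F_{\rm nat}(x^k)\|^2$ and $\psi(x^k)$ are integrable for every $k$, and $\mathbb{E}[\|F_{\rm nor}(z^k)\|^2]\to0$, $\mathbb{E}[\|F_{\rm nat}(x^k)\|^2]\to0$ and $\mathbb{E}[\psi(x^k)]\to\rho^*$ as $k\to\infty$ for some constant $\rho^*\in\mathbb{R}$. -/

import Mathlib

open MeasureTheory ProbabilityTheory Filter Topology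
open scoped NNReal ENNReal

/-- The function `φ : ℝᵈ → (-∞, ∞]` (with values in the extended reals) is proper, convex and
lower semicontinuous. -/
structure IsProperConvexLSC {d : ℕ} (φ : EuclideanSpace ℝ (Fin d) → EReal) : Prop where
  ne_bot : ∀ x, φ x ≠ ⊥
  exists_lt_top : ∃ x, φ x < ⊤
  convex : ∀ (x y : EuclideanSpace ℝ (Fin d)) (a b : ℝ), 0 < a → 0 < b → a + b = 1 →
    φ (a • x + b • y) ≤ (a : EReal) * φ x + (b : EReal) * φ y
  lsc : LowerSemicontinuous φ

/-- The composite objective `ψ = f + φ`. -/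
noncomputable def psi {d : ℕ} (f : EuclideanSpace ℝ (Fin d) → ℝ)
    (φ : EuclideanSpace ℝ (Fin d) → EReal) (x : EuclideanSpace ℝ (Fin d)) : EReal :=
  (f x : EReal) + φ x

/-- The proximity operator `prox_{lam φ}(x) = argmin_y φ(y) + ‖x - y‖² / (2 lam)`: a global
minimizer is selected (for `lam > 0` and a proper, convex, lower semicontinuous `φ` there is
exactly one). -/
noncomputable def prox {d : ℕ} (φ : EuclideanSpace ℝ (Fin d) → EReal) (lam : ℝ)
    (x : EuclideanSpace ℝ (Fin d)) : EuclideanSpace ℝ (Fin d) :=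
  Classical.epsilon fun p : EuclideanSpace ℝ (Fin d) =>
    IsMinOn (fun y => φ y + ((1 / (2 * lam) * ‖x - y‖ ^ 2 : ℝ) : EReal)) Set.univ p

/-- The gradient of the Moreau envelope, in its explicit form `(z - prox_{lam φ}(z)) / lam`. -/
noncomputable def gradEnv {d : ℕ} (φ : EuclideanSpace ℝ (Fin d) → EReal) (lam : ℝ)
    (z : EuclideanSpace ℝ (Fin d)) : EuclideanSpace ℝ (Fin d) :=
  (1 / lam) • (z - prox φ lam z)

/-- The normal map `F_nor(z) = ∇f(prox_{lam φ}(z)) + (z - prox_{lam φ}(z)) / lam`. -/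
noncomputable def Fnor {d : ℕ} (f : EuclideanSpace ℝ (Fin d) → ℝ)
    (φ : EuclideanSpace ℝ (Fin d) → EReal) (lam : ℝ)
    (z : EuclideanSpace ℝ (Fin d)) : EuclideanSpace ℝ (Fin d) :=
  gradient f (prox φ lam z) + gradEnv φ lam z

/-- The natural residual `F_nat(x) = x - prox_{lam φ}(x - lam ∇f(x))`. -/
noncomputable def Fnat {d : ℕ} (f : EuclideanSpace ℝ (Fin d) → ℝ)
    (φ : EuclideanSpace ℝ (Fin d) → EReal) (lam : ℝ)
    (x : EuclideanSpace ℝ (Fin d)) : EuclideanSpace ℝ (Fin d) :=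
  x - prox φ lam (x - lam • gradient f x)

/-- The stochastic processes `z` and `x` are generated by the normal map-based stochastic proximal
gradient method from the deterministic initial point `z0`, the proximal parameter `lam`, the step
sizes `α` and the stochastic gradient estimates `g`. -/
structure IsNorMSGD {d : ℕ} {Ω : Type*} (φ : EuclideanSpace ℝ (Fin d) → EReal) (lam : ℝ)
    (z0 : EuclideanSpace ℝ (Fin d)) (α : ℕ → ℝ)
    (g z x : ℕ → Ω → EuclideanSpace ℝ (Fin d)) : Prop where
  init : ∀ ω, z 0 ω = z0
  step : ∀ k ω, z (k + 1) ω = z k ω - α k • (g k ω + gradEnv φ lam (z k ω))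
  prox_eq : ∀ k ω, x k ω = prox φ lam (z k ω)

/-! The method is `z ← z - α (F_nor(z) + e)` with conditionally centred errors `e`. The function
`ψ(prox z) + κ ‖F_nor(z)‖²` is a Lyapunov function for it: for small `κ`, `exists_merit_descent`
gives a decrease of order `α ‖F_nor‖²` up to `α ‖perturbation‖²`. Applied to `e` directly, this
would cost `α ‖e‖²`, whereas only `∑ α² E‖e‖²` is controlled.

The remedy is to average the errors before using descent. The filtered noise `N ← (1 - α) N - α e`
is subtracted from the iterates; in the recursion of `y = z - N` the errors cancel, and what remains
is a normal map step with perturbation `O(‖N‖)` (`sub_filteredNoise_succ`,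
`exists_shifted_step_bounds`). Orthogonality of `N_k` and `e_k` gives `E‖N_{k+1}‖² ≤ (1 - α) E‖N_k‖²
+ α² E‖e_k‖²`. Since `E‖e_k‖²` depends on the objective value, this is coupled with the expected
descent inequality; a deterministic Robbins–Siegmund argument closes the loop
(`noise_energy_bounds`) and yields `∑ α E‖N‖² < ∞` and `E‖N‖² → 0`. A submartingale argument gives
`N → 0` almost surely (`ae_tendsto_filteredNoise`).

The descent inequalities for `y` hold for every outcome and are linear in the merit value, the
squared residual and `‖N‖²`, so they survive integration. Hence one lemma on real sequences,
`tendsto_of_descent`, proves both (a) and (b). -/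

/-! ### Existence, subgradient inequality and firm nonexpansiveness of the proximity operator. -/

section Prox

variable {d : ℕ} {φ : EuclideanSpace ℝ (Fin d) → EReal}

/-- A proper convex lsc function is minorized by a function of linear growth. -/
lemma IsProperConvexLSC.exists_linear_minorant (hφ : IsProperConvexLSC φ)
    {y₀ : EuclideanSpace ℝ (Fin d)} (hy₀ : φ y₀ < ⊤) :
    ∃ m D : ℝ, 0 ≤ D ∧ ∀ y, ((m - D * ‖y - y₀‖ : ℝ) : EReal) ≤ φ y := by
  obtain ⟨p, -, hp⟩ := (hφ.lsc.lowerSemicontinuousOn (Metric.closedBall y₀ 1)).exists_isMinOn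
    ⟨y₀, by simp⟩ (isCompact_closedBall y₀ 1)
  obtain ⟨m, -, hm⟩ := EReal.lt_iff_exists_real_btwn.1 (bot_lt_iff_ne_bot.2 (hφ.ne_bot p))
  have hball : ∀ y ∈ Metric.closedBall y₀ 1, (m : EReal) ≤ φ y := fun y hy =>
    hm.le.trans (isMinOn_iff.1 hp y hy)
  obtain ⟨r₀, hr₀⟩ : ∃ r : ℝ, φ y₀ = r :=
    ⟨_, (EReal.coe_toReal hy₀.ne (hφ.ne_bot _)).symm⟩
  have hmr : m ≤ r₀ := by
    have := hball y₀ (by simp)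
    rwa [hr₀, EReal.coe_le_coe_iff] at this
  refine ⟨m, r₀ - m, by linarith, fun y => ?_⟩
  by_cases hy : ‖y - y₀‖ ≤ 1
  · refine le_trans ?_ (hball y (by simpa [dist_eq_norm] using hy))
    rw [EReal.coe_le_coe_iff]
    nlinarith [norm_nonneg (y - y₀)]
  · push Not at hy
    rcases eq_or_ne (φ y) ⊤ with hT | hT
    · simp [hT]
    obtain ⟨s, hs⟩ : ∃ r : ℝ, φ y = r := ⟨_, (EReal.coe_toReal hT (hφ.ne_bot _)).symm⟩
    set r := ‖y - y₀‖ with hr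
    have hr0 : 0 < r := by linarith
    have hr1 : r⁻¹ < 1 := inv_lt_one_of_one_lt₀ hy
    -- The weight `r⁻¹` places the combination on the unit sphere about `y₀`, where `φ ≥ m`;
    -- convexity then bounds `φ y` from below.
    have h1 := hφ.convex y₀ y (1 - r⁻¹) r⁻¹ (by linarith) (by positivity) (by ring)
    have h2 := hball ((1 - r⁻¹) • y₀ + r⁻¹ • y) (by
      have : (1 - r⁻¹) • y₀ + r⁻¹ • y - y₀ = r⁻¹ • (y - y₀) := by module
      rw [Metric.mem_closedBall, dist_eq_norm, this, norm_smul, Real.norm_of_nonneg (by positivity),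
        ← hr, inv_mul_cancel₀ hr0.ne'])
    have h3 := h2.trans h1
    rw [hr₀, hs] at h3
    have h3 : m ≤ (1 - r⁻¹) * r₀ + r⁻¹ * s := by exact_mod_cast h3
    rw [hs, EReal.coe_le_coe_iff]
    have h4 := mul_le_mul_of_nonneg_left h3 hr0.le
    have h5 : r * ((1 - r⁻¹) * r₀ + r⁻¹ * s) = (r - 1) * r₀ + s := by field_simp
    nlinarith

/-- The quadratic term dominates the linear minorant, so a minimizer over a large enough closed ball
is global. -/
lemma IsProperConvexLSC.exists_isMinOn_prox (hφ : IsProperConvexLSC φ) {lam : ℝ} (hlam : 0 < lam)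
    (x : EuclideanSpace ℝ (Fin d)) :
    ∃ p, IsMinOn (fun y => φ y + ((1 / (2 * lam) * ‖x - y‖ ^ 2 : ℝ) : EReal)) Set.univ p := by
  obtain ⟨y₀, hy₀⟩ := hφ.exists_lt_top
  obtain ⟨m, D, hD, hmin⟩ := hφ.exists_linear_minorant hy₀
  obtain ⟨r₀, hr₀⟩ : ∃ r : ℝ, φ y₀ = r :=
    ⟨_, (EReal.coe_toReal hy₀.ne (hφ.ne_bot _)).symm⟩
  set a := ‖x - y₀‖ with ha
  have ha0 : 0 ≤ a := norm_nonneg _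
  set M := r₀ + 1 / (2 * lam) * a ^ 2 with hM
  set B := |D * a - m + M| with hB
  have hB0 : 0 ≤ B := abs_nonneg _
  -- For `s > s₀` one has `s / (2 lam) ≥ D + B + 1`: the quadratic term pays for the slope `D` and
  -- still exceeds the value `M` at `y₀`.
  set s₀ := 2 * lam * (D + B + 1) + 1 with hs₀
  have hs₀0 : 1 ≤ s₀ := by
    have : 0 ≤ 2 * lam * (D + B + 1) := by positivity
    linarith
  set Φ : EuclideanSpace ℝ (Fin d) → EReal :=
    fun y => φ y + ((1 / (2 * lam) * ‖x - y‖ ^ 2 : ℝ) : EReal) with hΦ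
  have hΦlsc : LowerSemicontinuous Φ := by
    refine hφ.lsc.add' ?_ fun y => ?_
    · exact (continuous_coe_real_ereal.comp (by fun_prop)).lowerSemicontinuous
    · exact EReal.continuousAt_add (Or.inr (EReal.coe_ne_bot _)) (Or.inr (EReal.coe_ne_top _))
  have hy₀R : y₀ ∈ Metric.closedBall y₀ (a + s₀) := by
    simp only [Metric.mem_closedBall, dist_self]; linarith
  obtain ⟨p, -, hp⟩ := (hΦlsc.lowerSemicontinuousOn (Metric.closedBall y₀ (a + s₀))).exists_isMinOn
    ⟨y₀, hy₀R⟩ (isCompact_closedBall _ _)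
  refine ⟨p, isMinOn_iff.2 fun y _ => ?_⟩
  by_cases hy : y ∈ Metric.closedBall y₀ (a + s₀)
  · exact isMinOn_iff.1 hp y hy
  refine (isMinOn_iff.1 hp y₀ hy₀R).trans ?_
  have h0 : Φ y₀ = (M : EReal) := by
    rw [hΦ]; simp only [hr₀, hM, ← ha]; norm_cast
  rw [h0]
  have h1 : ((m - D * ‖y - y₀‖ + 1 / (2 * lam) * ‖x - y‖ ^ 2 : ℝ) : EReal) ≤ Φ y := by
    rw [EReal.coe_add]; exact add_le_add_left (hmin y) _
  refine le_trans ?_ h1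
  rw [EReal.coe_le_coe_iff]
  rw [Metric.mem_closedBall, dist_eq_norm, not_le] at hy
  have htri : ‖y - y₀‖ - a ≤ ‖x - y‖ := by
    have : ‖y - y₀‖ ≤ ‖y - x‖ + ‖x - y₀‖ := norm_sub_le_norm_sub_add_norm_sub y x y₀
    rw [norm_sub_rev y x] at this; linarith
  set s := ‖y - y₀‖ - a with hs
  have hss : s₀ < s := by linarith
  have h2 : s ^ 2 ≤ ‖x - y‖ ^ 2 := pow_le_pow_left₀ (by linarith) htri 2
  have h3 : D + B + 1 ≤ s / (2 * lam) := by
    rw [le_div_iff₀ (by positivity)]; nlinarith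
  have h4 : 1 / (2 * lam) * s ^ 2 = s / (2 * lam) * s := by ring
  have h5 : 1 / (2 * lam) * s ^ 2 ≤ 1 / (2 * lam) * ‖x - y‖ ^ 2 := by gcongr
  have h6 : D * a - m + M ≤ B := le_abs_self _
  have h7 : ‖y - y₀‖ = a + s := by rw [hs]; ring
  rw [h7]
  have h8 : (D + B + 1) * s ≤ s / (2 * lam) * s := by gcongr; linarith
  nlinarith

lemma IsProperConvexLSC.isMinOn_prox (hφ : IsProperConvexLSC φ) {lam : ℝ} (hlam : 0 < lam)
    (x : EuclideanSpace ℝ (Fin d)) :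
    IsMinOn (fun y => φ y + ((1 / (2 * lam) * ‖x - y‖ ^ 2 : ℝ) : EReal)) Set.univ
      (prox φ lam x) :=
  Classical.epsilon_spec (hφ.exists_isMinOn_prox hlam x)

lemma IsProperConvexLSC.prox_lt_top (hφ : IsProperConvexLSC φ) {lam : ℝ} (hlam : 0 < lam)
    (x : EuclideanSpace ℝ (Fin d)) : φ (prox φ lam x) < ⊤ := by
  obtain ⟨y₀, hy₀⟩ := hφ.exists_lt_top
  have h := isMinOn_iff.1 (hφ.isMinOn_prox hlam x) y₀ trivial
  have h2 : φ y₀ + ((1 / (2 * lam) * ‖x - y₀‖ ^ 2 : ℝ) : EReal) < ⊤ :=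
    EReal.add_lt_top hy₀.ne (EReal.coe_ne_top _)
  have h3 := h.trans_lt h2
  by_contra hc
  rw [not_lt, top_le_iff] at hc
  simp only [hc, EReal.top_add_coe, lt_irrefl] at h3

/-- The vector `(x - prox x) / lam` is a subgradient of `φ` at `prox x`. -/
lemma IsProperConvexLSC.gradEnv_subgradient (hφ : IsProperConvexLSC φ) {lam : ℝ} (hlam : 0 < lam)
    (x : EuclideanSpace ℝ (Fin d)) {y : EuclideanSpace ℝ (Fin d)} (hy : φ y < ⊤) :
    (φ (prox φ lam x)).toReal + inner ℝ (gradEnv φ lam x) (y - prox φ lam x) ≤ (φ y).toReal := by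
  have hmin := isMinOn_iff.1 (hφ.isMinOn_prox hlam x)
  have hpT := hφ.prox_lt_top hlam x
  rw [gradEnv]
  set p := prox φ lam x with hp
  obtain ⟨s, hs⟩ : ∃ r : ℝ, φ y = r := ⟨_, (EReal.coe_toReal hy.ne (hφ.ne_bot _)).symm⟩
  obtain ⟨r, hr⟩ : ∃ r : ℝ, φ p = r := ⟨_, (EReal.coe_toReal hpT.ne (hφ.ne_bot _)).symm⟩
  rw [hs, hr, EReal.toReal_coe, EReal.toReal_coe, inner_smul_left]
  simp only [conj_trivial]
  -- Minimality of `p` is tested at `p + t (y - p)` and divided by `t`; the remaining quadratic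
  -- error vanishes as `t → 0`.
  have key : ∀ t : ℝ, 0 < t → t < 1 →
      r + 1 / lam * inner ℝ (x - p) (y - p) - t * (1 / (2 * lam) * ‖y - p‖ ^ 2) ≤ s := by
    intro t ht0 ht1
    have h1 := hφ.convex p y (1 - t) t (by linarith) ht0 (by ring)
    have h2 := hmin ((1 - t) • p + t • y) trivial
    have h3 := h2.trans (add_le_add_left h1 _)
    rw [hr, hs] at h3
    have h4 : r + 1 / (2 * lam) * ‖x - p‖ ^ 2 ≤
        (1 - t) * r + t * s + 1 / (2 * lam) * ‖x - ((1 - t) • p + t • y)‖ ^ 2 := by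
      exact_mod_cast h3
    have h5 : x - ((1 - t) • p + t • y) = (x - p) - t • (y - p) := by module
    rw [h5, norm_sub_sq_real (x - p), inner_smul_right, norm_smul, Real.norm_of_nonneg ht0.le] at h4
    have h6 : t * (r + 1 / lam * inner ℝ (x - p) (y - p) - t * (1 / (2 * lam) * ‖y - p‖ ^ 2))
        ≤ t * s := by
      have : 1 / lam = 2 * (1 / (2 * lam)) := by field_simp
      rw [this]
      nlinarith
    exact le_of_mul_le_mul_left h6 ht0
  have hlim : Tendsto (fun t : ℝ => r + 1 / lam * inner ℝ (x - p) (y - p)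
      - t * (1 / (2 * lam) * ‖y - p‖ ^ 2)) (𝓝[>] 0)
      (𝓝 (r + 1 / lam * inner ℝ (x - p) (y - p) - 0 * (1 / (2 * lam) * ‖y - p‖ ^ 2))) := by
    apply tendsto_nhdsWithin_of_tendsto_nhds
    apply Continuous.tendsto
    fun_prop
  rw [zero_mul, sub_zero] at hlim
  refine le_of_tendsto hlim ?_
  filter_upwards [Ioo_mem_nhdsGT (zero_lt_one : (0 : ℝ) < 1)] with t ht
  exact key t ht.1 ht.2

/-- The proximity operator is firmly nonexpansive. -/
lemma IsProperConvexLSC.prox_firm (hφ : IsProperConvexLSC φ) {lam : ℝ} (hlam : 0 < lam)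
    (z w : EuclideanSpace ℝ (Fin d)) :
    ‖prox φ lam w - prox φ lam z‖ ^ 2 ≤ inner ℝ (w - z) (prox φ lam w - prox φ lam z) := by
  have h1 := hφ.gradEnv_subgradient hlam z (hφ.prox_lt_top hlam w)
  have h2 := hφ.gradEnv_subgradient hlam w (hφ.prox_lt_top hlam z)
  rw [gradEnv, inner_smul_left] at h1 h2
  simp only [conj_trivial] at h1 h2
  set p := prox φ lam z
  set q := prox φ lam w
  -- Adding the two subgradient inequalities cancels the values of `φ`: monotonicity of the
  -- subdifferential.
  have h3 : 1 / lam * (inner ℝ (z - p) (q - p) + inner ℝ (w - q) (p - q)) ≤ 0 := by linarith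
  have h4 : inner ℝ (z - p) (q - p) + inner ℝ (w - q) (p - q) ≤ 0 := by
    by_contra hc
    push Not at hc
    have : 0 < 1 / lam := by positivity
    nlinarith
  have h5 : inner ℝ (z - p) (q - p) + inner ℝ (w - q) (p - q)
      = ‖q - p‖ ^ 2 - inner ℝ (w - z) (q - p) := by
    rw [← real_inner_self_eq_norm_sq, ← neg_sub q p, inner_neg_right, ← sub_eq_add_neg,
      ← inner_sub_left, ← inner_sub_left]
    congr 1; abel
  linarith

lemma IsProperConvexLSC.norm_prox_sub_le (hφ : IsProperConvexLSC φ) {lam : ℝ} (hlam : 0 < lam)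
    (z w : EuclideanSpace ℝ (Fin d)) : ‖prox φ lam w - prox φ lam z‖ ≤ ‖w - z‖ := by
  have h1 := hφ.prox_firm hlam z w
  have h2 := real_inner_le_norm (w - z) (prox φ lam w - prox φ lam z)
  by_contra hc
  push Not at hc
  nlinarith [norm_nonneg (w - z)]

/-- The natural residual at `prox z` is controlled by the normal map at `z`. -/
lemma IsProperConvexLSC.norm_Fnat_prox_le (hφ : IsProperConvexLSC φ) {lam : ℝ} (hlam : 0 < lam)
    (f : EuclideanSpace ℝ (Fin d) → ℝ) (z : EuclideanSpace ℝ (Fin d)) :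
    ‖Fnat f φ lam (prox φ lam z)‖ ≤ lam * ‖Fnor f φ lam z‖ := by
  rw [Fnat]
  -- Both points are proximal images, and their arguments differ by exactly `lam • F_nor(z)`.
  refine (hφ.norm_prox_sub_le hlam _ z).trans_eq ?_
  have : z - (prox φ lam z - lam • gradient f (prox φ lam z)) = lam • Fnor f φ lam z := by
    rw [Fnor, gradEnv, smul_add, smul_smul, mul_one_div_cancel hlam.ne', one_smul]; abel
  rw [this, norm_smul, Real.norm_of_nonneg hlam.le]

end Prox

/-! ### Regularity of the normal map and descent of the merit function. -/

section Descent

variable {d : ℕ} {φ : EuclideanSpace ℝ (Fin d) → EReal} {f : EuclideanSpace ℝ (Fin d) → ℝ}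
  {L : ℝ≥0} {lam : ℝ}

/-- Quadratic upper bound for a function with Lipschitz gradient. -/
lemma le_add_inner_gradient_add_sq {F : Type*} [NormedAddCommGroup F] [InnerProductSpace ℝ F]
    [CompleteSpace F] {f : F → ℝ} {L : ℝ≥0} (hf : Differentiable ℝ f)
    (hLip : LipschitzWith L (gradient f)) (x y : F) :
    f y ≤ f x + inner ℝ (gradient f x) (y - x) + L * ‖y - x‖ ^ 2 := by
  -- A single intermediate point gives the constant `L` instead of the sharp `L / 2`; constants play
  -- no role later.
  obtain ⟨c, hc, h⟩ := domain_mvt (f := f) (s := Set.univ) (x := x) (y := y)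
    (f' := fun u => InnerProductSpace.toDual ℝ F (gradient f u))
    (fun u _ => (hf u).hasGradientAt.hasFDerivAt.hasFDerivWithinAt) convex_univ trivial trivial
  rw [InnerProductSpace.toDual_apply_apply] at h
  have h1 : inner ℝ (gradient f c) (y - x)
      = inner ℝ (gradient f x) (y - x) + inner ℝ (gradient f c - gradient f x) (y - x) := by
    rw [← inner_add_left]; congr 1; abel
  have h2 := real_inner_le_norm (gradient f c - gradient f x) (y - x)
  have h3 := hLip.norm_sub_le c x
  have h4 : ‖c - x‖ ≤ ‖y - x‖ := by
    simpa [dist_eq_norm, norm_sub_rev] using norm_sub_le_of_mem_segment hc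
  have h5 : ‖gradient f c - gradient f x‖ * ‖y - x‖ ≤ L * ‖y - x‖ * ‖y - x‖ := by
    gcongr
    exact h3.trans (by gcongr)
  nlinarith

lemma toReal_psi_prox (hφ : IsProperConvexLSC φ) (hlam : 0 < lam)
    (z : EuclideanSpace ℝ (Fin d)) :
    (psi f φ (prox φ lam z)).toReal = f (prox φ lam z) + (φ (prox φ lam z)).toReal := by
  rw [psi, EReal.toReal_add (EReal.coe_ne_top _) (EReal.coe_ne_bot _)
    (hφ.prox_lt_top hlam z).ne (hφ.ne_bot _), EReal.toReal_coe]

lemma le_toReal_psi_prox (hφ : IsProperConvexLSC φ) (hlam : 0 < lam) {psiBar : ℝ}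
    (hbelow : ∀ y, φ y < ⊤ → (psiBar : EReal) ≤ psi f φ y) (z : EuclideanSpace ℝ (Fin d)) :
    psiBar ≤ (psi f φ (prox φ lam z)).toReal := by
  have hT := hφ.prox_lt_top hlam z
  have h := hbelow _ hT
  rw [toReal_psi_prox hφ hlam]
  rw [psi, ← EReal.coe_toReal hT.ne (hφ.ne_bot _)] at h
  exact_mod_cast h

/-- The subgradient of `φ` is taken at the new point `prox w`, which bounds its value from above;
rewriting it through `gradEnv` at `z` produces `F_nor(z)`, and the favourable term `-(1/lam) ‖prox w
- prox z‖²` is dropped. -/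
lemma toReal_psi_prox_le (hφ : IsProperConvexLSC φ) (hlam : 0 < lam) (hf : Differentiable ℝ f)
    (hLip : LipschitzWith L (gradient f)) (z w : EuclideanSpace ℝ (Fin d)) :
    (psi f φ (prox φ lam w)).toReal ≤ (psi f φ (prox φ lam z)).toReal
      + inner ℝ (Fnor f φ lam z) (prox φ lam w - prox φ lam z)
      + 1 / lam * inner ℝ (w - z) (prox φ lam w - prox φ lam z)
      + L * ‖prox φ lam w - prox φ lam z‖ ^ 2 := by
  rw [toReal_psi_prox hφ hlam, toReal_psi_prox hφ hlam]
  have h1 := hφ.gradEnv_subgradient hlam w (hφ.prox_lt_top hlam z)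
  have h2 := le_add_inner_gradient_add_sq hf hLip (prox φ lam z) (prox φ lam w)
  rw [Fnor, inner_add_left]
  have h3 : gradEnv φ lam w = gradEnv φ lam z
      + (1 / lam) • ((w - z) - (prox φ lam w - prox φ lam z)) := by
    rw [gradEnv, gradEnv]; module
  rw [← neg_sub (prox φ lam w), inner_neg_right, h3, inner_add_left, inner_smul_left,
    inner_sub_left, real_inner_self_eq_norm_sq] at h1
  simp only [conj_trivial] at h1
  have h4 : 0 ≤ 1 / lam * ‖prox φ lam w - prox φ lam z‖ ^ 2 := by positivity
  linarith

lemma Fnor_sub_eq (z w : EuclideanSpace ℝ (Fin d)) :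
    Fnor f φ lam w - Fnor f φ lam z
      = (gradient f (prox φ lam w) - gradient f (prox φ lam z))
        + (1 / lam) • ((w - z) - (prox φ lam w - prox φ lam z)) := by
  rw [Fnor, Fnor, gradEnv, gradEnv]; module

lemma norm_Fnor_sub_le (hφ : IsProperConvexLSC φ) (hlam : 0 < lam)
    (hLip : LipschitzWith L (gradient f)) (z w : EuclideanSpace ℝ (Fin d)) :
    ‖Fnor f φ lam w - Fnor f φ lam z‖ ≤ (L + 2 / lam) * ‖w - z‖ := by
  have hP := hφ.norm_prox_sub_le hlam z w
  have h1 : ‖gradient f (prox φ lam w) - gradient f (prox φ lam z)‖ ≤ L * ‖w - z‖ :=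
    (hLip.norm_sub_le _ _).trans (by gcongr)
  have h2 : ‖(1 / lam) • ((w - z) - (prox φ lam w - prox φ lam z))‖ ≤ 2 / lam * ‖w - z‖ := by
    rw [norm_smul, Real.norm_of_nonneg (by positivity)]
    have := norm_sub_le (w - z) (prox φ lam w - prox φ lam z)
    calc 1 / lam * ‖(w - z) - (prox φ lam w - prox φ lam z)‖
        ≤ 1 / lam * (‖w - z‖ + ‖w - z‖) := by gcongr; linarith
      _ = 2 / lam * ‖w - z‖ := by ring
  rw [Fnor_sub_eq, add_mul]
  exact (norm_add_le _ _).trans (add_le_add h1 h2)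

lemma toReal_psi_prox_sub_le (hφ : IsProperConvexLSC φ) (hlam : 0 < lam)
    (hf : Differentiable ℝ f) (hLip : LipschitzWith L (gradient f))
    (z w : EuclideanSpace ℝ (Fin d)) :
    (psi f φ (prox φ lam w)).toReal - (psi f φ (prox φ lam z)).toReal
      ≤ ‖Fnor f φ lam z‖ * ‖w - z‖ + (L + 2 / lam) * ‖w - z‖ ^ 2 := by
  have h := toReal_psi_prox_le hφ hlam hf hLip z w
  have hP := hφ.norm_prox_sub_le hlam z w
  have h1 : inner ℝ (Fnor f φ lam z) (prox φ lam w - prox φ lam z)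
      ≤ ‖Fnor f φ lam z‖ * ‖w - z‖ := (real_inner_le_norm _ _).trans (by gcongr)
  have h2 : 1 / lam * inner ℝ (w - z) (prox φ lam w - prox φ lam z)
      ≤ 1 / lam * ‖w - z‖ ^ 2 := by
    gcongr
    rw [sq]
    exact (real_inner_le_norm _ _).trans (by gcongr)
  have h3 : L * ‖prox φ lam w - prox φ lam z‖ ^ 2 ≤ L * ‖w - z‖ ^ 2 := by gcongr
  have h4 : 0 ≤ 1 / lam * ‖w - z‖ ^ 2 := by positivity
  have h5 : (L + 2 / lam) * ‖w - z‖ ^ 2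
      = L * ‖w - z‖ ^ 2 + (1 / lam * ‖w - z‖ ^ 2 + 1 / lam * ‖w - z‖ ^ 2) := by ring
  linarith

/-- The lower bound is the upper one with `z` and `w` exchanged; replacing `F_nor(w)` by `F_nor(z)`
costs the factor 2. Consequently `ψ ∘ prox` is continuous even though `φ` is only lower
semicontinuous. -/
lemma abs_toReal_psi_prox_sub_le (hφ : IsProperConvexLSC φ) (hlam : 0 < lam)
    (hf : Differentiable ℝ f) (hLip : LipschitzWith L (gradient f))
    (z w : EuclideanSpace ℝ (Fin d)) :
    |(psi f φ (prox φ lam w)).toReal - (psi f φ (prox φ lam z)).toReal|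
      ≤ ‖Fnor f φ lam z‖ * ‖w - z‖ + 2 * (L + 2 / lam) * ‖w - z‖ ^ 2 := by
  have hc : 0 ≤ (L + 2 / lam : ℝ) := by positivity
  have hsq : 0 ≤ (L + 2 / lam : ℝ) * ‖w - z‖ ^ 2 := by positivity
  rw [abs_sub_le_iff]
  constructor
  · have := toReal_psi_prox_sub_le hφ hlam hf hLip z w
    linarith
  · have h1 := toReal_psi_prox_sub_le hφ hlam hf hLip w z
    rw [norm_sub_rev z w] at h1
    have h2 : ‖Fnor f φ lam w‖ ≤ ‖Fnor f φ lam z‖ + (L + 2 / lam) * ‖w - z‖ := by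
      have := norm_Fnor_sub_le hφ hlam hLip z w
      have := norm_le_norm_add_norm_sub' (Fnor f φ lam w) (Fnor f φ lam z)
      linarith
    have h3 := mul_le_mul_of_nonneg_right h2 (norm_nonneg (w - z))
    nlinarith

lemma continuous_prox (hφ : IsProperConvexLSC φ) (hlam : 0 < lam) : Continuous (prox φ lam) :=
  (LipschitzWith.of_dist_le_mul (K := 1) fun w z => by
    simpa [dist_eq_norm] using hφ.norm_prox_sub_le hlam z w).continuous

lemma continuous_Fnor (hφ : IsProperConvexLSC φ) (hlam : 0 < lam)
    (hLip : LipschitzWith L (gradient f)) : Continuous (Fnor f φ lam) := by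
  have h1 := continuous_prox hφ hlam
  have h2 := hLip.continuous
  unfold Fnor gradEnv
  fun_prop

lemma continuous_Fnat (hφ : IsProperConvexLSC φ) (hlam : 0 < lam)
    (hLip : LipschitzWith L (gradient f)) : Continuous (Fnat f φ lam) := by
  have h1 := continuous_prox hφ hlam
  have h2 := hLip.continuous
  unfold Fnat
  fun_prop

lemma continuous_toReal_psi_prox (hφ : IsProperConvexLSC φ) (hlam : 0 < lam)
    (hf : Differentiable ℝ f) (hLip : LipschitzWith L (gradient f)) :
    Continuous fun z => (psi f φ (prox φ lam z)).toReal := by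
  rw [continuous_iff_continuousAt]
  intro z
  rw [ContinuousAt, tendsto_iff_dist_tendsto_zero]
  have hlim : Tendsto (fun w => ‖Fnor f φ lam z‖ * ‖w - z‖ + 2 * (L + 2 / lam) * ‖w - z‖ ^ 2)
      (𝓝 z) (𝓝 (‖Fnor f φ lam z‖ * ‖z - z‖ + 2 * (L + 2 / lam) * ‖z - z‖ ^ 2)) := by
    apply Continuous.tendsto
    fun_prop
  simp only [sub_self, norm_zero, mul_zero, ne_eq, OfNat.ofNat_ne_zero, not_false_eq_true,
    zero_pow, add_zero] at hlim
  exact squeeze_zero (fun _ => dist_nonneg)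
    (fun w => abs_toReal_psi_prox_sub_le hφ hlam hf hLip z w) hlim

/-- The scalar inequality behind `exists_merit_descent`. -/
lemma merit_descent_aux {κ lam c₁ C₂ L α s F n Ψw Ψz J I U V Q R u ω : ℝ} (hκ : 0 < κ)
    (hlam : 0 < lam) (hL : 0 ≤ L) (hκ1 : 4 * κ ≤ lam) (hκ2 : 16 * κ * (lam * L ^ 2) ≤ 1)
    (hC₂ : C₂ = κ * c₁ ^ 2 + (1 / lam + L)) (hC₂0 : 0 < C₂) (hα : 0 < α)
    (hα₀ : α ≤ κ / (4 * lam * C₂)) (hs0 : 0 ≤ s) (hn1 : 0 ≤ n)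
    (hΨ : Ψw ≤ Ψz + I + 1 / lam * J + L * (α * s) ^ 2) (hω : ω ≤ 2 * α ^ 2 * (F ^ 2 + n ^ 2))
    (hinner : U = V + 1 / lam * (-(α * (F ^ 2 + Q)) - I)) (hJle : J ≤ ω)
    (hFε : -(F * n) ≤ Q) (hεd : -(n * (α * s)) ≤ R) (hfirm : (α * s) ^ 2 ≤ -(α * (I + R)))
    (hFΔ' : V ≤ F * (L * (α * s))) (hdsq : (α * s) ^ 2 ≤ ω) (hu : u ≤ c₁ ^ 2 * ω) :
    Ψw + κ * (F ^ 2 + 2 * U + u) ≤ Ψz + κ * F ^ 2 - κ / (2 * lam) * α * F ^ 2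
      + (2 + 2 * κ / lam + κ / (2 * lam)) * α * n ^ 2 := by
  -- With `Δ = prox w - prox z` and `F_nor` at `z`: `F = ‖F_nor‖`, `n = ‖ε‖`, `α s = ‖Δ‖`, `I =
  -- ⟨F_nor, Δ⟩`, `J = ⟨w - z, Δ⟩`, `Q = ⟨F_nor, ε⟩`, `R = ⟨ε, Δ⟩`, `ω = ‖w - z‖²`; `U`, `V` pair
  -- `F_nor` with the increments of `F_nor` and `∇f`. The term `2 κ U` supplies four units of `-κ/(2
  -- lam) α F²`; `e2`, `e5` and `e6` spend one each and the last is the descent.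
  have e1 : Ψw ≤ Ψz + I + (1 / lam + L) * ω := by
    have h1 : 1 / lam * J ≤ 1 / lam * ω := by gcongr
    have h2 : L * (α * s) ^ 2 ≤ L * ω := by gcongr
    linarith
  have e2 : C₂ * ω ≤ κ / (2 * lam) * α * (F ^ 2 + n ^ 2) := by
    have h1 : α * (4 * lam * C₂) ≤ κ := (le_div_iff₀ (by positivity)).1 hα₀
    calc C₂ * ω ≤ C₂ * (2 * α ^ 2 * (F ^ 2 + n ^ 2)) := by gcongr
      _ = (α * (4 * lam * C₂)) / (2 * lam) * α * (F ^ 2 + n ^ 2) := by field_simp; ring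
      _ ≤ κ / (2 * lam) * α * (F ^ 2 + n ^ 2) := by gcongr
  have e3 : I ≤ α * (n * s - s ^ 2) := by
    have h0 := mul_le_mul_of_nonneg_left hεd hα.le
    have h1 : α * I ≤ α * (α * (n * s - s ^ 2)) := by linarith
    exact le_of_mul_le_mul_left h1 hα
  -- Firm nonexpansiveness makes `I` negative up to noise. The merit term takes back `2 κ / lam` of
  -- it, at most half since `4 κ ≤ lam`; the surviving `s²` absorbs the gradient term in `e5`.
  have e4 : (1 - 2 * (κ / lam)) * I ≤ α * (2 * n ^ 2 - 3 / 8 * s ^ 2) := by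
    have hν : κ / lam ≤ 1 / 4 := by rw [div_le_iff₀ hlam]; linarith
    have hν0 : 0 < κ / lam := by positivity
    have h1 : (1 - 2 * (κ / lam)) * (n * s - s ^ 2) ≤ 2 * n ^ 2 - 3 / 8 * s ^ 2 := by
      have h2 : 0 ≤ κ / lam * (n * s) := by positivity
      have h4 : 0 ≤ (1 / 4 - κ / lam) * s ^ 2 := mul_nonneg (by linarith) (sq_nonneg s)
      have h5 := sq_nonneg (s - 4 * n)
      linarith
    calc (1 - 2 * (κ / lam)) * I ≤ (1 - 2 * (κ / lam)) * (α * (n * s - s ^ 2)) := by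
          apply mul_le_mul_of_nonneg_left e3; linarith
      _ = α * ((1 - 2 * (κ / lam)) * (n * s - s ^ 2)) := by ring
      _ ≤ _ := by gcongr
  have e5 : 2 * κ * V ≤ α * (κ / (2 * lam) * F ^ 2 + 1 / 8 * s ^ 2) := by
    have h1 : 2 * κ * L * F * s ≤ κ / (2 * lam) * F ^ 2 + 1 / 8 * s ^ 2 := by
      have h2 : 2 * κ * (lam * L ^ 2) * s ^ 2 ≤ 1 / 8 * s ^ 2 := by gcongr; linarith
      have h3 : 0 ≤ κ / (2 * lam) * (F - 2 * lam * L * s) ^ 2 := by positivity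
      have h4 : κ / (2 * lam) * (F - 2 * lam * L * s) ^ 2 = κ / (2 * lam) * F ^ 2
          - 2 * κ * L * F * s + 2 * κ * (lam * L ^ 2) * s ^ 2 := by field_simp; ring
      linarith
    calc 2 * κ * V ≤ 2 * κ * (F * (L * (α * s))) := by gcongr
      _ = α * (2 * κ * L * F * s) := by ring
      _ ≤ _ := by gcongr
  have e6 : -(2 * (κ / lam) * α * Q) ≤ α * (κ / (2 * lam) * F ^ 2 + 2 * κ / lam * n ^ 2) := by
    have h1 : 2 * (κ / lam) * (F * n) ≤ κ / (2 * lam) * F ^ 2 + 2 * κ / lam * n ^ 2 := by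
      have h3 : 0 ≤ κ / (2 * lam) * (F - 2 * n) ^ 2 := by positivity
      have h4 : κ / (2 * lam) * (F - 2 * n) ^ 2 = κ / (2 * lam) * F ^ 2
          - 2 * (κ / lam) * (F * n) + 2 * κ / lam * n ^ 2 := by field_simp; ring
      linarith
    calc -(2 * (κ / lam) * α * Q) = 2 * (κ / lam) * α * (-Q) := by ring
      _ ≤ 2 * (κ / lam) * α * (F * n) := by gcongr; linarith
      _ = α * (2 * (κ / lam) * (F * n)) := by ring
      _ ≤ _ := by gcongr
  have e7 : κ * u ≤ κ * (c₁ ^ 2 * ω) := by gcongr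
  have e8 : 2 * κ * U = 2 * κ * V - 2 * κ / lam * α * F ^ 2 - 2 * (κ / lam) * α * Q
      - 2 * (κ / lam) * I := by rw [hinner]; field_simp; ring
  have e9 : C₂ * ω = κ * (c₁ ^ 2 * ω) + (1 / lam + L) * ω := by rw [hC₂]; ring
  have e10 : 2 * κ / lam * α * F ^ 2 = 4 * (κ / (2 * lam) * α * F ^ 2) := by field_simp; ring
  have e11 : 0 ≤ α * s ^ 2 := by positivity
  linarith

/-- Approximate descent of the merit function `ψ(prox z) + κ ‖F_nor(z)‖²` along perturbed normal
map steps. -/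
lemma exists_merit_descent (hφ : IsProperConvexLSC φ) (hlam : 0 < lam)
    (hf : Differentiable ℝ f) (hLip : LipschitzWith L (gradient f)) :
    ∃ κ c C α₀ : ℝ, 0 < κ ∧ 0 < c ∧ 0 < C ∧ 0 < α₀ ∧
      ∀ (z ε : EuclideanSpace ℝ (Fin d)) (α : ℝ), 0 < α → α ≤ α₀ →
        (psi f φ (prox φ lam (z - α • (Fnor f φ lam z + ε)))).toReal
          + κ * ‖Fnor f φ lam (z - α • (Fnor f φ lam z + ε))‖ ^ 2
        ≤ (psi f φ (prox φ lam z)).toReal + κ * ‖Fnor f φ lam z‖ ^ 2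
          - c * α * ‖Fnor f φ lam z‖ ^ 2 + C * α * ‖ε‖ ^ 2 := by
  obtain ⟨κ, hκ, hκ1, hκ2⟩ : ∃ κ : ℝ, 0 < κ ∧ 4 * κ ≤ lam ∧ 16 * κ * (lam * L ^ 2) ≤ 1 := by
    -- The `+ 1` keeps the denominator positive when `L = 0`.
    refine ⟨min (lam / 4) (1 / (16 * (lam * L ^ 2 + 1))), by positivity, ?_, ?_⟩
    · have := min_le_left (lam / 4) (1 / (16 * (lam * L ^ 2 + 1)))
      linarith
    · have h1 := min_le_right (lam / 4) (1 / (16 * (lam * L ^ 2 + 1)))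
      have h0 : 0 ≤ lam * (L : ℝ) ^ 2 := by positivity
      calc 16 * min (lam / 4) (1 / (16 * (lam * L ^ 2 + 1))) * (lam * L ^ 2)
          ≤ 16 * (1 / (16 * (lam * L ^ 2 + 1))) * (lam * L ^ 2 + 1) := by gcongr; linarith
        _ = 1 := by field_simp
  set c₁ : ℝ := L + 2 / lam with hc₁
  set C₂ : ℝ := κ * c₁ ^ 2 + (1 / lam + L) with hC₂
  have hc₁0 : 0 < c₁ := by positivity
  have hC₂0 : 0 < C₂ := by positivity
  refine ⟨κ, κ / (2 * lam), 2 + 2 * κ / lam + κ / (2 * lam), κ / (4 * lam * C₂), hκ,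
    by positivity, by positivity, by positivity, fun z ε α hα hα₀ => ?_⟩
  set w := z - α • (Fnor f φ lam z + ε) with hw
  have hwz : w - z = -(α • (Fnor f φ lam z + ε)) := by rw [hw]; abel
  have hΨ := toReal_psi_prox_le hφ hlam hf hLip z w
  have hfirm := hφ.prox_firm hlam z w
  have hP := hφ.norm_prox_sub_le hlam z w
  have hFd := norm_Fnor_sub_le hφ hlam hLip z w
  have hΔ := hLip.norm_sub_le (prox φ lam w) (prox φ lam z)
  have hFw : Fnor f φ lam w = Fnor f φ lam z + (Fnor f φ lam w - Fnor f φ lam z) := by abel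
  have hsq : ‖Fnor f φ lam w‖ ^ 2 = ‖Fnor f φ lam z‖ ^ 2
      + 2 * inner ℝ (Fnor f φ lam z) (Fnor f φ lam w - Fnor f φ lam z)
      + ‖Fnor f φ lam w - Fnor f φ lam z‖ ^ 2 := by
    conv_lhs => rw [hFw]
    exact norm_add_sq_real _ _
  have hω : ‖w - z‖ ^ 2 ≤ 2 * α ^ 2 * (‖Fnor f φ lam z‖ ^ 2 + ‖ε‖ ^ 2) := by
    rw [hwz, norm_neg, norm_smul, Real.norm_of_nonneg hα.le, mul_pow]
    have h1 := norm_add_le (Fnor f φ lam z) ε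
    have h2 : ‖Fnor f φ lam z + ε‖ ^ 2 ≤ (‖Fnor f φ lam z‖ + ‖ε‖) ^ 2 := by gcongr
    have h3 : ‖Fnor f φ lam z + ε‖ ^ 2 ≤ 2 * (‖Fnor f φ lam z‖ ^ 2 + ‖ε‖ ^ 2) := by
      nlinarith [sq_nonneg (‖Fnor f φ lam z‖ - ‖ε‖)]
    nlinarith [sq_nonneg α]
  have hinner : inner ℝ (Fnor f φ lam z) (Fnor f φ lam w - Fnor f φ lam z)
      = inner ℝ (Fnor f φ lam z) (gradient f (prox φ lam w) - gradient f (prox φ lam z))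
        + 1 / lam * (-(α * (‖Fnor f φ lam z‖ ^ 2 + inner ℝ (Fnor f φ lam z) ε))
          - inner ℝ (Fnor f φ lam z) (prox φ lam w - prox φ lam z)) := by
    rw [Fnor_sub_eq z w, inner_add_right, inner_smul_right,
      inner_sub_right _ (w - z), hwz, inner_neg_right,
      inner_smul_right, inner_add_right, real_inner_self_eq_norm_sq]
  have hJ : inner ℝ (w - z) (prox φ lam w - prox φ lam z)
      = -(α * (inner ℝ (Fnor f φ lam z) (prox φ lam w - prox φ lam z)
        + inner ℝ ε (prox φ lam w - prox φ lam z))) := by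
    rw [hwz, inner_neg_left, inner_smul_left, inner_add_left]; simp
  have hJle : inner ℝ (w - z) (prox φ lam w - prox φ lam z) ≤ ‖w - z‖ ^ 2 := by
    rw [sq]; exact (real_inner_le_norm _ _).trans (by gcongr)
  have hFΔ := real_inner_le_norm (Fnor f φ lam z)
    (gradient f (prox φ lam w) - gradient f (prox φ lam z))
  have hFε := neg_le_of_abs_le (abs_real_inner_le_norm (Fnor f φ lam z) ε)
  have hεd := neg_le_of_abs_le (abs_real_inner_le_norm ε (prox φ lam w - prox φ lam z))
  have hn0 := norm_nonneg (Fnor f φ lam z)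
  have hn1 := norm_nonneg ε
  have hn2 := norm_nonneg (prox φ lam w - prox φ lam z)
  rw [hJ] at hfirm
  have hFΔ' := hFΔ.trans (mul_le_mul_of_nonneg_left hΔ hn0)
  have hdsq : ‖prox φ lam w - prox φ lam z‖ ^ 2 ≤ ‖w - z‖ ^ 2 := by gcongr
  have hFd2 : ‖Fnor f φ lam w - Fnor f φ lam z‖ ^ 2 ≤ c₁ ^ 2 * ‖w - z‖ ^ 2 := by
    rw [← mul_pow]; gcongr
  rw [hsq]
  -- Displacement per unit step size, so that the estimates become quadratic forms in `F`, `n`, `s`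
  -- with a common factor `α`.
  obtain ⟨s, hs⟩ : ∃ s, s = ‖prox φ lam w - prox φ lam z‖ / α := ⟨_, rfl⟩
  have hs0 : 0 ≤ s := by rw [hs]; positivity
  have hδs : ‖prox φ lam w - prox φ lam z‖ = α * s := by rw [hs]; field_simp
  rw [hδs] at hfirm hεd hFΔ' hdsq hΨ
  generalize (psi f φ (prox φ lam w)).toReal = Ψw at *
  generalize (psi f φ (prox φ lam z)).toReal = Ψz at *
  generalize inner ℝ (w - z) (prox φ lam w - prox φ lam z) = J at *
  generalize inner ℝ (Fnor f φ lam z) (prox φ lam w - prox φ lam z) = I at *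
  generalize inner ℝ (Fnor f φ lam z) (Fnor f φ lam w - Fnor f φ lam z) = U at *
  generalize inner ℝ (Fnor f φ lam z) (gradient f (prox φ lam w) - gradient f (prox φ lam z))
    = V at *
  generalize inner ℝ (Fnor f φ lam z) ε = Q at *
  generalize inner ℝ ε (prox φ lam w - prox φ lam z) = R at *
  generalize ‖Fnor f φ lam w - Fnor f φ lam z‖ ^ 2 = u at *
  generalize ‖w - z‖ ^ 2 = ω at *
  generalize ‖Fnor f φ lam z‖ = F at *
  generalize ‖ε‖ = n at *
  exact merit_descent_aux hκ hlam L.2 hκ1 hκ2 hC₂ hC₂0 hα hα₀ hs0 hn1 hΨ hω hinner hJle hFε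
    hεd hfirm hFΔ' hdsq hFd2

end Descent

/-! ### Real sequences: Robbins–Siegmund arguments. -/

section Sequences

/-- A sequence bounded below which decreases up to summable errors converges, and its decrements
are summable. -/
lemma exists_tendsto_and_summable_of_le_sub_add {a b q : ℕ → ℝ} {m : ℝ} (hm : ∀ k, m ≤ a k)
    (hb : ∀ k, 0 ≤ b k) (hq : Summable q)
    (h : ∀ᶠ k in atTop, a (k + 1) ≤ a k - b k + q k) :
    (∃ l, Tendsto a atTop (𝓝 l)) ∧ Summable b := by
  obtain ⟨K, hK⟩ := eventually_atTop.1 h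
  have hqK : Summable fun k => q (k + K) := (summable_nat_add_iff K).2 hq
  have hqt := hqK.hasSum.tendsto_sum_nat
  obtain ⟨B, hB⟩ := hqt.bddAbove_range
  have hB : ∀ n, ∑ i ∈ Finset.range n, q (i + K) ≤ B := fun n => hB ⟨n, rfl⟩
  have hstep : ∀ n, a (n + 1 + K) ≤ a (n + K) - b (n + K) + q (n + K) := fun n => by
    have := hK (n + K) (by omega)
    rwa [show n + K + 1 = n + 1 + K by omega] at this
  constructor
  -- Subtracting the accumulated errors leaves a monotone sequence.
  · have hanti : Antitone fun n => a (n + K) - ∑ i ∈ Finset.range n, q (i + K) := by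
      refine antitone_nat_of_succ_le fun n => ?_
      rw [Finset.sum_range_succ]
      have := hstep n
      have := hb (n + K)
      linarith
    have hbdd : BddBelow (Set.range fun n => a (n + K) - ∑ i ∈ Finset.range n, q (i + K)) := by
      refine ⟨m - B, ?_⟩
      rintro _ ⟨n, rfl⟩
      have := hB n
      have := hm (n + K)
      simp only
      linarith
    refine ⟨_, (tendsto_add_atTop_iff_nat K).1
      (((tendsto_atTop_ciInf hanti hbdd).add hqt).congr fun n => ?_)⟩
    ring
  · refine (summable_nat_add_iff K).1
      (summable_of_sum_range_le (c := a K - m + B) (fun n => hb _) fun n => ?_)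
    have : ∑ i ∈ Finset.range n, b (i + K) ≤
        a K - a (n + K) + ∑ i ∈ Finset.range n, q (i + K) := by
      induction n with
      | zero => simp
      | succ n ih =>
        rw [Finset.sum_range_succ, Finset.sum_range_succ]
        have := hstep n
        linarith
    have := hB n
    have := hm (n + K)
    linarith

/-- If the weights `α` have infinite sum while `∑ α a` converges, then a limit of the
nonnegative sequence `a` vanishes. -/
lemma tendsto_zero_of_summable_mul {a α : ℕ → ℝ} {l : ℝ} (ha : ∀ k, 0 ≤ a k) (hα : ∀ k, 0 < α k)
    (hα_sum : Tendsto (fun n => ∑ k ∈ Finset.range n, α k) atTop atTop)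
    (hl : Tendsto a atTop (𝓝 l)) (hs : Summable fun k => α k * a k) : Tendsto a atTop (𝓝 0) := by
  have hl0 : 0 ≤ l := ge_of_tendsto' hl ha
  rcases hl0.eq_or_lt with rfl | hpos
  · exact hl
  exfalso
  have hev : ∀ᶠ k in atTop, l / 2 ≤ a k := hl.eventually_const_le (by linarith)
  have hsum : Summable α := by
    refine (hs.mul_left (2 / l)).of_norm_bounded_eventually_nat ?_
    filter_upwards [hev] with k hk
    rw [Real.norm_of_nonneg (hα k).le]
    calc α k = 2 / l * (α k * (l / 2)) := by field_simp
      _ ≤ 2 / l * (α k * a k) := by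
        have := (hα k).le
        gcongr
  exact not_tendsto_nhds_of_tendsto_atTop hα_sum _ hsum.hasSum.tendsto_sum_nat

/-- A discrete Gronwall inequality with summable coefficients. -/
lemma exists_eventually_le_of_le_one_add_mul {a p q : ℕ → ℝ} (ha : ∀ k, 0 ≤ a k)
    (hp0 : ∀ k, 0 ≤ p k) (hq0 : ∀ k, 0 ≤ q k) (hp : Summable p) (hq : Summable q)
    (h : ∀ᶠ k in atTop, a (k + 1) ≤ (1 + p k) * a k + q k) :
    ∃ B, 0 ≤ B ∧ ∀ᶠ k in atTop, a k ≤ B := by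
  obtain ⟨K, hK⟩ := eventually_atTop.1 h
  have hpK : Summable fun k => p (k + K) := (summable_nat_add_iff K).2 hp
  have hqK : Summable fun k => q (k + K) := (summable_nat_add_iff K).2 hq
  have key : ∀ n, a (n + K) ≤ (a K + ∑ i ∈ Finset.range n, q (i + K)) *
      Real.exp (∑ i ∈ Finset.range n, p (i + K)) := by
    intro n
    induction n with
    | zero => simp
    | succ n ih =>
      have hstep : a (n + 1 + K) ≤ (1 + p (n + K)) * a (n + K) + q (n + K) := by
        have := hK (n + K) (by omega)
        rwa [show n + K + 1 = n + 1 + K by omega] at this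
      have hS : 0 ≤ a K + ∑ i ∈ Finset.range n, q (i + K) :=
        add_nonneg (ha K) (Finset.sum_nonneg fun i _ => hq0 _)
      have hP : 0 ≤ ∑ i ∈ Finset.range n, p (i + K) := Finset.sum_nonneg fun i _ => hp0 _
      have hp1 := hp0 (n + K)
      have hq1 := hq0 (n + K)
      rw [Finset.sum_range_succ, Finset.sum_range_succ, Real.exp_add]
      set S := ∑ i ∈ Finset.range n, q (i + K)
      set T := Real.exp (∑ i ∈ Finset.range n, p (i + K)) with hT
      have hT1 : 1 ≤ T := Real.one_le_exp hP
      have he : 1 + p (n + K) ≤ Real.exp (p (n + K)) := by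
        have := Real.add_one_le_exp (p (n + K)); linarith
      have he1 : 1 ≤ Real.exp (p (n + K)) := Real.one_le_exp hp1
      have h1 : (1 + p (n + K)) * a (n + K) ≤ Real.exp (p (n + K)) * ((a K + S) * T) := by
        have := ha (n + K)
        gcongr
      have h2 : q (n + K) ≤ q (n + K) * (T * Real.exp (p (n + K))) :=
        le_mul_of_one_le_right hq1 (one_le_mul_of_one_le_of_one_le hT1 he1)
      linarith
  refine ⟨(a K + ∑' i, q (i + K)) * Real.exp (∑' i, p (i + K)), ?_, ?_⟩
  · have h1 : 0 ≤ ∑' i, q (i + K) := tsum_nonneg fun i => hq0 _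
    have := ha K
    positivity
  · filter_upwards [eventually_ge_atTop K] with k hk
    obtain ⟨n, rfl⟩ := Nat.exists_eq_add_of_le' hk
    refine (key n).trans ?_
    have h1 := hqK.sum_le_tsum (Finset.range n) fun i _ => hq0 _
    have h2 := hpK.sum_le_tsum (Finset.range n) fun i _ => hp0 _
    have h3 : 0 ≤ a K + ∑' i, q (i + K) := add_nonneg (ha K) (tsum_nonneg fun i => hq0 _)
    gcongr

/-- The deterministic Robbins–Siegmund lemma. -/
lemma exists_tendsto_and_summable_of_le_one_add_mul {a b p q : ℕ → ℝ} (ha : ∀ k, 0 ≤ a k)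
    (hb : ∀ k, 0 ≤ b k) (hp0 : ∀ k, 0 ≤ p k) (hq0 : ∀ k, 0 ≤ q k) (hp : Summable p)
    (hq : Summable q) (h : ∀ᶠ k in atTop, a (k + 1) ≤ (1 + p k) * a k - b k + q k) :
    (∃ l, Tendsto a atTop (𝓝 l)) ∧ Summable b := by
  obtain ⟨B, hB0, hB⟩ := exists_eventually_le_of_le_one_add_mul ha hp0 hq0 hp hq
    (h.mono fun k hk => by have := hb k; linarith)
  -- Once `a` is bounded by `B`, the growth `p k * a k` is just another summable error.
  refine exists_tendsto_and_summable_of_le_sub_add ha hb ((hp.mul_right B).add hq) ?_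
  filter_upwards [h, hB] with k hk hBk
  have := mul_le_mul_of_nonneg_left hBk (hp0 k)
  linarith

/-- Convergence of the merit values `h`, the squared residuals `a`, `r` and the objective values
`s` from the one-step inequalities with perturbations `n`. -/
lemma tendsto_of_descent {h a n r s α : ℕ → ℝ} {κ c C m : ℝ} (hc : 0 < c)
    (hm : ∀ k, m ≤ h k) (ha : ∀ k, 0 ≤ a k) (hr : ∀ k, 0 ≤ r k)
    (hα : ∀ k, 0 < α k)
    (hα_sum : Tendsto (fun n => ∑ k ∈ Finset.range n, α k) atTop atTop)
    (hstep : ∀ᶠ k in atTop, h (k + 1) ≤ h k - c * α k * a k + C * α k * n k)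
    (hres : ∀ᶠ k in atTop, a (k + 1) ≤ a k + C * α k * (a k + n k))
    (hrle : ∀ k, r k ≤ C * (a k + n k))
    (hs : ∀ k, |s k - (h k - κ * a k)| ≤ C * (a k + n k))
    (hnsum : Summable fun k => α k * n k) (hn0 : Tendsto n atTop (𝓝 0)) :
    Tendsto r atTop (𝓝 0) ∧ ∃ l, Tendsto s atTop (𝓝 l) := by
  obtain ⟨⟨l, hl⟩, hsum⟩ := exists_tendsto_and_summable_of_le_sub_add (a := h)
    (b := fun k => c * (α k * a k)) (q := fun k => C * (α k * n k)) hm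
    (fun k => mul_nonneg hc.le (mul_nonneg (hα k).le (ha k))) (hnsum.mul_left C)
    (hstep.mono fun k hk => by simp only [← mul_assoc]; exact hk)
  have hasum : Summable fun k => α k * a k := (summable_mul_left_iff hc.ne').1 hsum
  -- Summability of `α a` alone does not make `a` converge; `hres` does, as its increments are
  -- bounded above by summable terms.
  obtain ⟨⟨l', hl'⟩, -⟩ := exists_tendsto_and_summable_of_le_sub_add (a := a)
    (b := fun _ => 0) (q := fun k => C * (α k * a k + α k * n k)) ha (fun _ => le_rfl)
    ((hasum.add hnsum).mul_left C) (hres.mono fun k hk => by linarith)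
  have ha0 : Tendsto a atTop (𝓝 0) := tendsto_zero_of_summable_mul ha hα hα_sum hl' hasum
  have han : Tendsto (fun k => C * (a k + n k)) atTop (𝓝 0) := by
    simpa using (ha0.add hn0).const_mul C
  refine ⟨squeeze_zero hr hrle han, l, ?_⟩
  have h1 : Tendsto (fun k => s k - (h k - κ * a k)) atTop (𝓝 0) :=
    squeeze_zero_norm (fun k => by rw [Real.norm_eq_abs]; exact hs k) han
  have h2 : Tendsto (fun k => s k - (h k - κ * a k) + (h k - κ * a k)) atTop
      (𝓝 (0 + (l - κ * 0))) := h1.add (hl.sub (ha0.const_mul κ))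
  simpa using h2

end Sequences

/-! ### Descent for the noise-shifted iterates. -/

section Merit

variable {d : ℕ} {φ : EuclideanSpace ℝ (Fin d) → EReal} {f : EuclideanSpace ℝ (Fin d) → ℝ}
  {L : ℝ≥0} {lam : ℝ}

/-- The merit function `ψ(prox z) + κ ‖F_nor(z)‖²`. -/
noncomputable def merit (f : EuclideanSpace ℝ (Fin d) → ℝ)
    (φ : EuclideanSpace ℝ (Fin d) → EReal) (lam κ : ℝ) (z : EuclideanSpace ℝ (Fin d)) : ℝ :=
  (psi f φ (prox φ lam z)).toReal + κ * ‖Fnor f φ lam z‖ ^ 2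

lemma sq_le_of_le_add_mul {x a b n : ℝ} (hx : 0 ≤ x) (h : x ≤ a + b * n) :
    x ^ 2 ≤ 2 * (1 + b ^ 2) * (a ^ 2 + n ^ 2) := by
  have h1 := pow_le_pow_left₀ hx h 2
  linarith [sq_nonneg (a - b * n), sq_nonneg (b * a), sq_nonneg n]

/-- One-step inequalities for the step `z ↦ z - α (F_nor(z + N) - N)`. -/
lemma exists_shifted_step_bounds (hφ : IsProperConvexLSC φ) (hlam : 0 < lam)
    (hf : Differentiable ℝ f) (hLip : LipschitzWith L (gradient f)) :
    ∃ κ c C α₀ : ℝ, 0 < κ ∧ 0 < c ∧ 0 < C ∧ 0 < α₀ ∧ α₀ ≤ 1 ∧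
      ∀ z N : EuclideanSpace ℝ (Fin d),
        |(psi f φ (prox φ lam (z + N))).toReal - (psi f φ (prox φ lam z)).toReal|
          ≤ C * (‖Fnor f φ lam z‖ ^ 2 + ‖N‖ ^ 2) ∧
        ‖Fnor f φ lam (z + N)‖ ^ 2 ≤ C * (‖Fnor f φ lam z‖ ^ 2 + ‖N‖ ^ 2) ∧
        ∀ α : ℝ, 0 < α → α ≤ α₀ →
          merit f φ lam κ (z - α • (Fnor f φ lam (z + N) - N)) ≤ merit f φ lam κ z
            - c * α * ‖Fnor f φ lam z‖ ^ 2 + C * α * ‖N‖ ^ 2 ∧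
          ‖Fnor f φ lam (z - α • (Fnor f φ lam (z + N) - N))‖ ^ 2 ≤ ‖Fnor f φ lam z‖ ^ 2
            + C * α * (‖Fnor f φ lam z‖ ^ 2 + ‖N‖ ^ 2) := by
  obtain ⟨κ, c, C, α₀, hκ, hc, hC, hα₀, H⟩ := exists_merit_descent hφ hlam hf hLip
  obtain ⟨b, hb⟩ : ∃ b : ℝ, b = L + 2 / lam := ⟨_, rfl⟩
  have hb0 : 0 < b := by rw [hb]; positivity
  -- One summand for each of the four inequalities to be proved.
  obtain ⟨C', hC'⟩ : ∃ C' : ℝ, C' = (1 + 2 * b) + 2 * (1 + b ^ 2) + C * (b + 1) ^ 2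
    + (b + 2 * (b + b ^ 2) * (1 + (b + 1) ^ 2)) := ⟨_, rfl⟩
  have p1 : 0 ≤ 1 + 2 * b := by positivity
  have p2 : 0 ≤ 2 * (1 + b ^ 2) := by positivity
  have p3 : 0 ≤ C * (b + 1) ^ 2 := by positivity
  have p4 : 0 ≤ b + 2 * (b + b ^ 2) * (1 + (b + 1) ^ 2) := by positivity
  have q1 : 1 + 2 * b ≤ C' := by linarith
  have q2 : 2 * (1 + b ^ 2) ≤ C' := by linarith
  have q3 : C * (b + 1) ^ 2 ≤ C' := by linarith
  have q4 : b + 2 * (b + b ^ 2) * (1 + (b + 1) ^ 2) ≤ C' := by linarith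
  clear hC'
  -- The cap at 1 gives `α² ≤ α` in the last bound, and later makes the truncation in
  -- `filteredNoise` inactive.
  refine ⟨κ, c, C', min α₀ 1, hκ, hc, by linarith, by positivity, min_le_right _ _,
    fun z N => ?_⟩
  have hFN : ‖Fnor f φ lam (z + N) - Fnor f φ lam z‖ ≤ b * ‖N‖ := by
    simpa [hb] using norm_Fnor_sub_le hφ hlam hLip z (z + N)
  have hn0 := norm_nonneg (Fnor f φ lam z)
  have hn1 := norm_nonneg N
  refine ⟨?_, ?_, fun α hα hαle => ⟨?_, ?_⟩⟩
  · have h1 := abs_toReal_psi_prox_sub_le hφ hlam hf hLip z (z + N)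
    rw [add_sub_cancel_left, ← hb] at h1
    refine h1.trans ?_
    calc ‖Fnor f φ lam z‖ * ‖N‖ + 2 * b * ‖N‖ ^ 2
        ≤ (1 + 2 * b) * (‖Fnor f φ lam z‖ ^ 2 + ‖N‖ ^ 2) := by
          linarith [sq_nonneg (‖Fnor f φ lam z‖ - ‖N‖), sq_nonneg ‖Fnor f φ lam z‖, sq_nonneg ‖N‖,
            mul_nonneg hb0.le (sq_nonneg ‖Fnor f φ lam z‖)]
      _ ≤ C' * (‖Fnor f φ lam z‖ ^ 2 + ‖N‖ ^ 2) := by gcongr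
  · have h1 : ‖Fnor f φ lam (z + N)‖ ≤ ‖Fnor f φ lam z‖ + b * ‖N‖ := by
      have := norm_le_norm_add_norm_sub' (Fnor f φ lam (z + N)) (Fnor f φ lam z)
      linarith
    exact (sq_le_of_le_add_mul (norm_nonneg _) h1).trans
      (mul_le_mul_of_nonneg_right q2 (by positivity))
  -- This perturbation turns the step into an exact normal map step at `z`; by Lipschitz continuity
  -- it is `O(‖N‖)`.
  · have h1 := H z (Fnor f φ lam (z + N) - Fnor f φ lam z - N) α hα (hαle.trans (min_le_left _ _))
    have h2 : Fnor f φ lam z + (Fnor f φ lam (z + N) - Fnor f φ lam z - N)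
        = Fnor f φ lam (z + N) - N := by abel
    rw [h2] at h1
    refine h1.trans ?_
    have h3 : ‖Fnor f φ lam (z + N) - Fnor f φ lam z - N‖ ≤ (b + 1) * ‖N‖ :=
      (norm_sub_le _ _).trans (by linarith)
    have h4 : C * α * ‖Fnor f φ lam (z + N) - Fnor f φ lam z - N‖ ^ 2 ≤ C' * α * ‖N‖ ^ 2 :=
      calc _ ≤ C * α * ((b + 1) * ‖N‖) ^ 2 :=
            mul_le_mul_of_nonneg_left (pow_le_pow_left₀ (norm_nonneg _) h3 2) (by positivity)
        _ = C * (b + 1) ^ 2 * α * ‖N‖ ^ 2 := by ring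
        _ ≤ C' * α * ‖N‖ ^ 2 := by gcongr
    rw [merit]
    linarith
  · have hα1 : α ≤ 1 := hαle.trans (min_le_right _ _)
    obtain ⟨G, hG⟩ : ∃ G, G = ‖Fnor f φ lam (z + N) - N‖ := ⟨_, rfl⟩
    have hG0 : 0 ≤ G := hG ▸ norm_nonneg _
    have h1 : ‖Fnor f φ lam (z - α • (Fnor f φ lam (z + N) - N))‖
        ≤ ‖Fnor f φ lam z‖ + b * (α * G) := by
      have h2 := norm_Fnor_sub_le hφ hlam hLip z (z - α • (Fnor f φ lam (z + N) - N))
      rw [sub_sub_cancel_left, norm_neg, norm_smul, Real.norm_of_nonneg hα.le, ← hG, ← hb] at h2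
      have := norm_le_norm_add_norm_sub' (Fnor f φ lam (z - α • (Fnor f φ lam (z + N) - N)))
        (Fnor f φ lam z)
      linarith
    have h3 : G ≤ ‖Fnor f φ lam z‖ + (b + 1) * ‖N‖ := by
      have h4 := norm_le_norm_add_norm_sub' (Fnor f φ lam (z + N)) (Fnor f φ lam z)
      have h5 := norm_sub_le (Fnor f φ lam (z + N)) N
      linarith
    have h6 := sq_le_of_le_add_mul hG0 h3
    have h9 := pow_le_pow_left₀ (norm_nonneg _) h1 2
    refine h9.trans ?_
    clear h9 h1 H hFN hφ hf hLip
    generalize ‖Fnor f φ lam z‖ = F at *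
    generalize ‖N‖ = n at *
    have hS0 : 0 ≤ F ^ 2 + n ^ 2 := by positivity
    have h7 : 2 * (F * G) ≤ (F ^ 2 + n ^ 2) + G ^ 2 := by
      linarith [sq_nonneg (F - G), sq_nonneg n]
    have h8 : α ^ 2 ≤ α := by rw [sq]; exact mul_le_of_le_one_left hα.le hα1
    generalize F ^ 2 + n ^ 2 = S at *
    calc (F + b * (α * G)) ^ 2
        = F ^ 2 + b * α * (2 * (F * G)) + b ^ 2 * α ^ 2 * G ^ 2 := by ring
      _ ≤ F ^ 2 + b * α * (S + G ^ 2) + b ^ 2 * α * G ^ 2 := by gcongr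
      _ = F ^ 2 + b * α * S + (b + b ^ 2) * α * G ^ 2 := by ring
      _ ≤ F ^ 2 + b * α * S + (b + b ^ 2) * α * (2 * (1 + (b + 1) ^ 2) * S) := by gcongr
      _ = F ^ 2 + (b + 2 * (b + b ^ 2) * (1 + (b + 1) ^ 2)) * α * S := by ring
      _ ≤ F ^ 2 + C' * α * S := by gcongr

end Merit

/-! ### Second moments and almost sure decay of the filtered noise. -/

section FilteredNoise

variable {Ω E : Type*} [NormedAddCommGroup E] [InnerProductSpace ℝ E]

/-- The exponentially filtered noise `N₀ = 0`, `N_{k+1} = (1 - min (α_k) 1) N_k - α_k e_k`. -/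
noncomputable def filteredNoise (α : ℕ → ℝ) (e : ℕ → Ω → E) : ℕ → Ω → E
  | 0 => fun _ => 0
  | k + 1 => fun ω => (1 - min (α k) 1) • filteredNoise α e k ω - α k • e k ω

variable {mΩ : MeasurableSpace Ω} {P : Measure Ω} {ℱ : Filtration ℕ mΩ} {α : ℕ → ℝ} {e : ℕ → Ω → E}

lemma stronglyMeasurable_filteredNoise (he : ∀ k, StronglyMeasurable[ℱ (k + 1)] (e k)) (k : ℕ) :
    StronglyMeasurable[ℱ k] (filteredNoise α e k) := by
  induction k with
  | zero => exact stronglyMeasurable_const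
  | succ k ih =>
    exact ((ih.mono (ℱ.mono (Nat.le_succ k))).const_smul _).sub ((he k).const_smul _)

lemma memLp_filteredNoise (he : ∀ k, MemLp (e k) 2 P) (k : ℕ) :
    MemLp (filteredNoise α e k) 2 P := by
  induction k with
  | zero => exact MemLp.zero'
  | succ k ih => exact (ih.const_smul _).sub ((he k).const_smul _)

lemma integrable_norm_sq_of_memLp_two {F : Type*} [NormedAddCommGroup F] {X : Ω → F} (hX : MemLp X 2 P) :
    Integrable (fun ω => ‖X ω‖ ^ 2) P :=
  (memLp_two_iff_integrable_sq_norm hX.1).1 hX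

/-- By Tonelli the sum has finite expectation in `[0, ∞]`, so it is finite almost surely. -/
lemma ae_summable_of_summable_integral {X : ℕ → Ω → ℝ} (hX : ∀ k ω, 0 ≤ X k ω)
    (hint : ∀ k, Integrable (X k) P) (hs : Summable fun k => ∫ ω, X k ω ∂P) :
    ∀ᵐ ω ∂P, Summable fun k => X k ω := by
  have h1 : ∫⁻ ω, ∑' k, ENNReal.ofReal (X k ω) ∂P ≠ ∞ := by
    rw [lintegral_tsum fun k => (hint k).1.aemeasurable.ennreal_ofReal]
    have : ∀ k, ∫⁻ ω, ENNReal.ofReal (X k ω) ∂P = ENNReal.ofReal (∫ ω, X k ω ∂P) := fun k =>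
      (ofReal_integral_eq_lintegral_ofReal (hint k) (ae_of_all _ (hX k))).symm
    simp_rw [this]
    exact hs.tsum_ofReal_ne_top
  have h2 := ae_lt_top' (AEMeasurable.tsum fun k =>
    (hint k).1.aemeasurable.ennreal_ofReal) h1
  filter_upwards [h2] with ω hω
  have h3 := ENNReal.summable_toReal hω.ne
  simpa only [ENNReal.toReal_ofReal (hX _ ω)] using h3

lemma integrable_inner_of_memLp_two {X Y : Ω → E} (hX : MemLp X 2 P) (hY : MemLp Y 2 P) :
    Integrable (fun ω => inner ℝ (X ω) (Y ω)) P := by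
  refine ((integrable_norm_sq_of_memLp_two hX).add (integrable_norm_sq_of_memLp_two hY)).mono'
    (hX.1.inner hY.1) (ae_of_all _ fun ω => ?_)
  have h1 := abs_real_inner_le_norm (X ω) (Y ω)
  rw [Real.norm_eq_abs]
  simp only [Pi.add_apply]
  nlinarith [sq_nonneg (‖X ω‖ - ‖Y ω‖), sq_nonneg ‖X ω‖, sq_nonneg ‖Y ω‖]

lemma norm_sq_filteredNoise_succ (k : ℕ) (ω : Ω) :
    ‖filteredNoise α e (k + 1) ω‖ ^ 2 = (1 - min (α k) 1) ^ 2 * ‖filteredNoise α e k ω‖ ^ 2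
      - 2 * (1 - min (α k) 1) * α k * inner ℝ (filteredNoise α e k ω) (e k ω)
      + α k ^ 2 * ‖e k ω‖ ^ 2 := by
  rw [filteredNoise, norm_sub_sq_real, norm_smul, norm_smul, inner_smul_left, inner_smul_right,
    mul_pow, mul_pow, Real.norm_eq_abs, Real.norm_eq_abs, sq_abs, sq_abs]
  simp only [conj_trivial]
  ring

variable [CompleteSpace E] [IsProbabilityMeasure P]

/-- `N_k` involves only `e_0, …, e_{k-1}`, so it is known at time `k` and factors out of the
conditional expectation. -/
lemma condExp_inner_filteredNoise (hem : ∀ k, StronglyMeasurable[ℱ (k + 1)] (e k))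
    (he : ∀ k, MemLp (e k) 2 P) (he0 : ∀ k, P[e k | ℱ k] =ᵐ[P] 0) (k : ℕ) :
    P[fun ω => inner ℝ (filteredNoise α e k ω) (e k ω) | ℱ k] =ᵐ[P] 0 := by
  have h := condExp_bilin_of_stronglyMeasurable_left (μ := P) (m := ℱ k) (innerSL ℝ)
    (stronglyMeasurable_filteredNoise (α := α) hem k)
    (integrable_inner_of_memLp_two (memLp_filteredNoise he k) (he k))
    ((he k).integrable one_le_two)
  filter_upwards [h, he0 k] with ω h1 h2
  refine Eq.trans h1 ?_
  rw [h2]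
  simp

/-- The cross term has mean zero. Truncating `α k` at 1 keeps the damping factor in `[0, 1]`, where
its square is at most itself. -/
lemma integral_norm_sq_filteredNoise_succ_le (hα : ∀ k, 0 < α k)
    (hem : ∀ k, StronglyMeasurable[ℱ (k + 1)] (e k))
    (he : ∀ k, MemLp (e k) 2 P) (he0 : ∀ k, P[e k | ℱ k] =ᵐ[P] 0) (k : ℕ) :
    ∫ ω, ‖filteredNoise α e (k + 1) ω‖ ^ 2 ∂P ≤
      (1 - min (α k) 1) * ∫ ω, ‖filteredNoise α e k ω‖ ^ 2 ∂P
        + α k ^ 2 * ∫ ω, ‖e k ω‖ ^ 2 ∂P := by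
  have hN := memLp_filteredNoise (α := α) he k
  have h1 := (integrable_norm_sq_of_memLp_two hN).const_mul ((1 - min (α k) 1) ^ 2)
  have h2 := (integrable_inner_of_memLp_two hN (he k)).const_mul (2 * (1 - min (α k) 1) * α k)
  have h3 := (integrable_norm_sq_of_memLp_two (he k)).const_mul (α k ^ 2)
  have h12 : Integrable (fun ω => (1 - min (α k) 1) ^ 2 * ‖filteredNoise α e k ω‖ ^ 2
      - 2 * (1 - min (α k) 1) * α k * inner ℝ (filteredNoise α e k ω) (e k ω)) P := h1.sub h2
  have h4 : ∫ ω, inner ℝ (filteredNoise α e k ω) (e k ω) ∂P = 0 := by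
    rw [← integral_condExp (ℱ.le k), integral_congr_ae (condExp_inner_filteredNoise hem he he0 k)]
    simp
  simp_rw [norm_sq_filteredNoise_succ]
  rw [integral_add h12 h3, integral_sub h1 h2, integral_const_mul, integral_const_mul,
    integral_const_mul, h4]
  have h5 : 0 ≤ ∫ ω, ‖filteredNoise α e k ω‖ ^ 2 ∂P := integral_nonneg fun _ => sq_nonneg _
  have h6 : 0 ≤ min (α k) 1 := le_min (hα k).le zero_le_one
  have h7 : min (α k) 1 ≤ 1 := min_le_right _ _
  have h8 : (1 - min (α k) 1) ^ 2 ≤ 1 - min (α k) 1 := by nlinarith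
  have := mul_le_mul_of_nonneg_right h8 h5
  linarith

/-- The filtered noise vanishes almost surely in the limit. -/
lemma ae_tendsto_filteredNoise (hα : ∀ k, 0 < α k)
    (hα_sum : Tendsto (fun n => ∑ k ∈ Finset.range n, α k) atTop atTop)
    (hem : ∀ k, StronglyMeasurable[ℱ (k + 1)] (e k))
    (he : ∀ k, MemLp (e k) 2 P) (he0 : ∀ k, P[e k | ℱ k] =ᵐ[P] 0)
    (hes : Summable fun k => α k ^ 2 * ∫ ω, ‖e k ω‖ ^ 2 ∂P) {B : ℝ}
    (hB : ∀ k, ∫ ω, ‖filteredNoise α e k ω‖ ^ 2 ∂P ≤ B)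
    (hN : ∀ᵐ ω ∂P, Summable fun k => α k * ‖filteredNoise α e k ω‖ ^ 2) :
    ∀ᵐ ω ∂P, Tendsto (fun k => ‖filteredNoise α e k ω‖ ^ 2) atTop (𝓝 0) := by
  have heint : ∀ k, Integrable (fun ω => α k ^ 2 * ‖e k ω‖ ^ 2) P := fun k =>
    (integrable_norm_sq_of_memLp_two (he k)).const_mul _
  have hNint : ∀ k, Integrable (fun ω => ‖filteredNoise α e k ω‖ ^ 2) P := fun k =>
    integrable_norm_sq_of_memLp_two (memLp_filteredNoise he k)
  -- The conditional increments of `D` are `(1 - b²) ‖N_k‖² ≥ 0` with `b` the damping factor, and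
  -- `D` is bounded in `L¹`; so it converges almost surely, and with it `‖N_k‖²`.
  set D : ℕ → Ω → ℝ := fun k ω =>
    ∑ i ∈ Finset.range k, α i ^ 2 * ‖e i ω‖ ^ 2 - ‖filteredNoise α e k ω‖ ^ 2 with hD
  have hDint : ∀ k, Integrable (D k) P := fun k =>
    (integrable_finsetSum _ fun i _ => heint i).sub (hNint k)
  have hsub : Submartingale D ℱ P := by
    refine submartingale_of_condExp_sub_nonneg_nat (fun k => ?_) hDint fun k => ?_
    · refine StronglyMeasurable.sub (Finset.stronglyMeasurable_fun_sum _ fun i hi => ?_)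
        ((stronglyMeasurable_filteredNoise hem k).norm.pow 2)
      exact (((hem i).mono (ℱ.mono (by have := Finset.mem_range.1 hi; omega))).norm.pow 2).const_mul _
    · set b := 1 - min (α k) 1 with hb
      have hdiff : D (k + 1) - D k = (fun ω => (1 - b ^ 2) * ‖filteredNoise α e k ω‖ ^ 2)
          + (2 * b * α k) • fun ω => inner ℝ (filteredNoise α e k ω) (e k ω) := by
        ext ω
        simp only [hD, Pi.sub_apply, Pi.add_apply, Pi.smul_apply, smul_eq_mul,
          Finset.sum_range_succ, norm_sq_filteredNoise_succ]
        ring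
      have hb0 : 0 ≤ b := by
        have := min_le_right (α k) 1
        linarith
      have hb1 : b ≤ 1 := by
        have : 0 ≤ min (α k) 1 := le_min (hα k).le zero_le_one
        linarith
      have h1 : 0 ≤ᵐ[P] P[fun ω => (1 - b ^ 2) * ‖filteredNoise α e k ω‖ ^ 2 | ℱ k] :=
        condExp_nonneg (ae_of_all _ fun ω => mul_nonneg (by nlinarith) (sq_nonneg _))
      have hint := integrable_inner_of_memLp_two (memLp_filteredNoise (α := α) he k) (he k)
      rw [hdiff]
      filter_upwards [condExp_add ((hNint k).const_mul (1 - b ^ 2)) (hint.smul (2 * b * α k)) (ℱ k),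
        condExp_smul (μ := P) (2 * b * α k)
          (fun ω => inner ℝ (filteredNoise α e k ω) (e k ω)) (ℱ k),
        condExp_inner_filteredNoise (α := α) hem he he0 k, h1] with ω g1 g2 g3 g4
      rw [g1, Pi.add_apply, g2, Pi.smul_apply, g3]
      simpa using g4
  have hbdd : ∀ k, eLpNorm (D k) 1 P ≤
      ((Real.toNNReal (∑' k, α k ^ 2 * ∫ ω, ‖e k ω‖ ^ 2 ∂P + B) : ℝ≥0) : ℝ≥0∞) := fun k => by
    rw [eLpNorm_one_eq_lintegral_enorm, ← ofReal_integral_norm_eq_lintegral_enorm (hDint k)]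
    refine ENNReal.ofReal_le_ofReal ?_
    calc ∫ ω, ‖D k ω‖ ∂P
        ≤ ∫ ω, (∑ i ∈ Finset.range k, α i ^ 2 * ‖e i ω‖ ^ 2 + ‖filteredNoise α e k ω‖ ^ 2) ∂P := by
          refine integral_mono (hDint k).norm
            ((integrable_finsetSum _ fun i _ => heint i).add (hNint k)) fun ω => ?_
          have h1 : 0 ≤ ∑ i ∈ Finset.range k, α i ^ 2 * ‖e i ω‖ ^ 2 :=
            Finset.sum_nonneg fun i _ => by positivity
          have h2 : 0 ≤ ‖filteredNoise α e k ω‖ ^ 2 := by positivity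
          simp only [hD, Real.norm_eq_abs]
          rw [abs_sub_le_iff]
          constructor <;> linarith
      _ = ∑ i ∈ Finset.range k, α i ^ 2 * ∫ ω, ‖e i ω‖ ^ 2 ∂P
          + ∫ ω, ‖filteredNoise α e k ω‖ ^ 2 ∂P := by
          rw [integral_add (integrable_finsetSum _ fun i _ => heint i) (hNint k),
            integral_finsetSum _ fun i _ => heint i]
          simp_rw [integral_const_mul]
      _ ≤ _ := by
          refine add_le_add (hes.sum_le_tsum _ fun i _ => ?_) (hB k)
          exact mul_nonneg (sq_nonneg _) (integral_nonneg fun _ => sq_nonneg _)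
  have hesum : ∀ᵐ ω ∂P, Summable fun k => α k ^ 2 * ‖e k ω‖ ^ 2 :=
    ae_summable_of_summable_integral (fun k ω => by positivity) heint
      (by simpa only [integral_const_mul] using hes)
  filter_upwards [hsub.ae_tendsto_limitProcess hbdd, hesum, hN] with ω h1 h2 h3
  have h4 := h2.hasSum.tendsto_sum_nat.sub h1
  simp only [hD, sub_sub_cancel] at h4
  exact tendsto_zero_of_summable_mul (fun k => sq_nonneg _) hα hα_sum h4 h3

end FilteredNoise

/-! ### Square integrability of the iterates and removal of the noise. -/

section Iterates

variable {d : ℕ} {φ : EuclideanSpace ℝ (Fin d) → EReal} {f : EuclideanSpace ℝ (Fin d) → ℝ}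
  {L : ℝ≥0} {lam : ℝ} {Ω : Type*} {mΩ : MeasurableSpace Ω} {P : Measure Ω} [IsProbabilityMeasure P]

lemma memLp_Fnor_comp (hφ : IsProperConvexLSC φ) (hlam : 0 < lam)
    (hLip : LipschitzWith L (gradient f)) {z : Ω → EuclideanSpace ℝ (Fin d)}
    (hz : MemLp z 2 P) : MemLp (fun ω => Fnor f φ lam (z ω)) 2 P := by
  refine MemLp.of_le (g := fun ω => (L + 2 / lam) * ‖z ω‖ + ‖Fnor f φ lam 0‖)
    ((hz.norm.const_mul _).add (memLp_const _))
    ((continuous_Fnor hφ hlam hLip).comp_aestronglyMeasurable hz.1) (ae_of_all _ fun ω => ?_)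
  have h1 := norm_Fnor_sub_le hφ hlam hLip 0 (z ω)
  have h2 := norm_le_norm_add_norm_sub' (Fnor f φ lam (z ω)) (Fnor f φ lam 0)
  rw [sub_zero] at h1
  exact (by linarith : _ ≤ (L + 2 / lam) * ‖z ω‖ + ‖Fnor f φ lam 0‖).trans (le_abs_self _)

/-- Comparison with the origin shows that `ψ ∘ prox` grows at most quadratically. -/
lemma integrable_toReal_psi_prox (hφ : IsProperConvexLSC φ) (hlam : 0 < lam)
    (hf : Differentiable ℝ f) (hLip : LipschitzWith L (gradient f))
    {z : Ω → EuclideanSpace ℝ (Fin d)} (hz : MemLp z 2 P) :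
    Integrable (fun ω => (psi f φ (prox φ lam (z ω))).toReal) P := by
  have hint : Integrable (fun ω => |(psi f φ (prox φ lam 0)).toReal| +
      (‖Fnor f φ lam 0‖ * ‖z ω‖ + 2 * (L + 2 / lam) * ‖z ω‖ ^ 2)) P :=
    (integrable_const _).add (((hz.integrable one_le_two).norm.const_mul _).add
      ((integrable_norm_sq_of_memLp_two hz).const_mul _))
  refine hint.mono' ((continuous_toReal_psi_prox hφ hlam hf hLip).comp_aestronglyMeasurable hz.1)
    (ae_of_all _ fun ω => ?_)
  have h1 := abs_toReal_psi_prox_sub_le hφ hlam hf hLip 0 (z ω)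
  rw [sub_zero] at h1
  have h2 := abs_sub_abs_le_abs_sub (psi f φ (prox φ lam (z ω))).toReal
    (psi f φ (prox φ lam 0)).toReal
  rw [Real.norm_eq_abs]
  linarith

/-- The conditional second moment bound makes the gradient error square integrable. -/
lemma memLp_two_and_integral_le_of_condLExp_le {E : Type*} [NormedAddCommGroup E] {e : Ω → E}
    (he : AEStronglyMeasurable e P) {u : Ω → ℝ} (hu : Integrable u P) (hu0 : ∀ ω, 0 ≤ u ω)
    {m : MeasurableSpace Ω} (hm : m ≤ mΩ)
    (h : condLExp m P (fun ω => ‖e ω‖ₑ ^ 2) ≤ᵐ[P] fun ω => ENNReal.ofReal (u ω)) :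
    MemLp e 2 P ∧ ∫ ω, ‖e ω‖ ^ 2 ∂P ≤ ∫ ω, u ω ∂P := by
  have h1 : ∫⁻ ω, ‖‖e ω‖ ^ 2‖ₑ ∂P ≤ ENNReal.ofReal (∫ ω, u ω ∂P) := by
    simp_rw [enorm_pow, enorm_norm]
    -- Working in `[0, ∞]` makes integrability of `‖e‖²` a conclusion rather than a premise.
    rw [← lintegral_condLExp hm, ofReal_integral_eq_lintegral_ofReal hu (ae_of_all _ hu0)]
    exact lintegral_mono_ae h
  have h2 : Integrable (fun ω => ‖e ω‖ ^ 2) P :=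
    ⟨he.norm.pow 2, h1.trans_lt ENNReal.ofReal_lt_top⟩
  refine ⟨(memLp_two_iff_integrable_sq_norm he).2 h2, ?_⟩
  rw [← ofReal_integral_norm_eq_lintegral_enorm h2,
    ENNReal.ofReal_le_ofReal_iff (integral_nonneg hu0)] at h1
  simpa using h1

/-- Square integrability and adaptedness of the iterates and of the gradient errors. -/
lemma iterates_memLp (hφ : IsProperConvexLSC φ) (hlam : 0 < lam)
    (hf : Differentiable ℝ f) (hLip : LipschitzWith L (gradient f)) {psiBar : ℝ}
    (hbelow : ∀ y, φ y < ⊤ → (psiBar : EReal) ≤ psi f φ y) {ℱ : Filtration ℕ mΩ}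
    {z0 : EuclideanSpace ℝ (Fin d)} {α : ℕ → ℝ} {g z : ℕ → Ω → EuclideanSpace ℝ (Fin d)}
    (hinit : ∀ ω, z 0 ω = z0)
    (hstep : ∀ k ω, z (k + 1) ω = z k ω - α k • (g k ω + gradEnv φ lam (z k ω)))
    (hg_meas : ∀ k, Measurable[ℱ (k + 1)] (g k)) {A : ℝ} (hA : 0 ≤ A) {σ : ℕ → ℝ}
    (hg_var : ∀ k, condLExp (ℱ k) P
        (fun ω => ‖g k ω - gradient f (prox φ lam (z k ω))‖ₑ ^ 2) ≤ᵐ[P]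
      fun ω => ENNReal.ofReal
        (σ k ^ 2 + A * ((psi f φ (prox φ lam (z k ω))).toReal - psiBar))) (k : ℕ) :
    StronglyMeasurable[ℱ k] (z k) ∧ MemLp (z k) 2 P ∧
    StronglyMeasurable[ℱ (k + 1)] (fun ω => g k ω - gradient f (prox φ lam (z k ω))) ∧
    MemLp (fun ω => g k ω - gradient f (prox φ lam (z k ω))) 2 P ∧
    ∫ ω, ‖g k ω - gradient f (prox φ lam (z k ω))‖ ^ 2 ∂P ≤
      σ k ^ 2 + A * ∫ ω, ((psi f φ (prox φ lam (z k ω))).toReal - psiBar) ∂P := by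
  -- Half of an alternating induction: `z_k ∈ L²` makes `ψ(x_k)` integrable, hence `e_k ∈ L²`, hence
  -- `z_{k+1} ∈ L²`.
  have herr : ∀ k, StronglyMeasurable[ℱ k] (z k) → MemLp (z k) 2 P →
      StronglyMeasurable[ℱ (k + 1)] (fun ω => g k ω - gradient f (prox φ lam (z k ω))) ∧
      MemLp (fun ω => g k ω - gradient f (prox φ lam (z k ω))) 2 P ∧
      ∫ ω, ‖g k ω - gradient f (prox φ lam (z k ω))‖ ^ 2 ∂P ≤
        σ k ^ 2 + A * ∫ ω, ((psi f φ (prox φ lam (z k ω))).toReal - psiBar) ∂P := by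
    intro k hzm hz
    have hem : StronglyMeasurable[ℱ (k + 1)]
        (fun ω => g k ω - gradient f (prox φ lam (z k ω))) :=
      (hg_meas k).stronglyMeasurable.sub
        ((hLip.continuous.comp (continuous_prox hφ hlam)).comp_stronglyMeasurable
          (hzm.mono (ℱ.mono (Nat.le_succ k))))
    have hΨ : Integrable (fun ω => (psi f φ (prox φ lam (z k ω))).toReal - psiBar) P :=
      (integrable_toReal_psi_prox hφ hlam hf hLip hz).sub (integrable_const _)
    have h := memLp_two_and_integral_le_of_condLExp_le
      (hem.mono (ℱ.le _)).aestronglyMeasurable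
      ((integrable_const (σ k ^ 2)).add (hΨ.const_mul A))
      (fun ω => by
        have := le_toReal_psi_prox hφ hlam hbelow (z k ω)
        exact add_nonneg (sq_nonneg _) (mul_nonneg hA (by linarith))) (ℱ.le k) (hg_var k)
    refine ⟨hem, h.1, h.2.trans_eq ?_⟩
    simp only [Pi.add_apply]
    rw [integral_add (integrable_const _) (hΨ.const_mul A), integral_const_mul]
    simp
  have hz : StronglyMeasurable[ℱ k] (z k) ∧ MemLp (z k) 2 P := by
    induction k with
    | zero =>
      have : z 0 = fun _ => z0 := funext hinit
      rw [this]
      exact ⟨stronglyMeasurable_const, memLp_const _⟩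
    | succ k ih =>
      have hz : z (k + 1) = fun ω => z k ω - α k • ((g k ω - gradient f (prox φ lam (z k ω)))
          + Fnor f φ lam (z k ω)) := by
        ext1 ω
        rw [hstep, Fnor]
        congr 2
        abel
      obtain ⟨h1, h2, -⟩ := herr k ih.1 ih.2
      have hzm := ih.1.mono (ℱ.mono (Nat.le_succ k))
      rw [hz]
      exact ⟨hzm.sub ((h1.add
          ((continuous_Fnor hφ hlam hLip).comp_stronglyMeasurable hzm)).const_smul (α k)),
        ih.2.sub ((h2.add (memLp_Fnor_comp hφ hlam hLip ih.2)).const_smul (α k))⟩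
  exact ⟨hz.1, hz.2, herr k hz.1 hz.2⟩

/-- Removing the filtered noise from the iterates leaves a step of the form treated in
`exists_shifted_step_bounds`. -/
lemma sub_filteredNoise_succ {α : ℕ → ℝ} {g z : ℕ → Ω → EuclideanSpace ℝ (Fin d)}
    (hstep : ∀ k ω, z (k + 1) ω = z k ω - α k • (g k ω + gradEnv φ lam (z k ω)))
    {e : ℕ → Ω → EuclideanSpace ℝ (Fin d)}
    (he : ∀ k ω, e k ω = g k ω - gradient f (prox φ lam (z k ω))) {k : ℕ} (hk : α k ≤ 1) (ω : Ω) :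
    z (k + 1) ω - filteredNoise α e (k + 1) ω
      = (z k ω - filteredNoise α e k ω) - α k •
        (Fnor f φ lam ((z k ω - filteredNoise α e k ω) + filteredNoise α e k ω)
          - filteredNoise α e k ω) := by
  rw [hstep, filteredNoise, min_eq_left hk, sub_add_cancel, Fnor]
  simp only [he]
  module

end Iterates

/-! ### Closing the loop between objective and noise, and the main theorem. -/

/-- The coupled recursion of the merit values `h` and the noise energies `n`. -/
lemma noise_energy_bounds {h a n s α σ : ℕ → ℝ} {c C A C' : ℝ} (hc : 0 < c) (hC : 0 < C)
    (hA : 0 ≤ A) (hC' : 0 ≤ C') (hh : ∀ k, 0 ≤ h k) (ha : ∀ k, 0 ≤ a k) (hn : ∀ k, 0 ≤ n k)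
    (hs : ∀ k, 0 ≤ s k) (hα : ∀ k, 0 < α k)
    (hα_sum : Tendsto (fun n => ∑ k ∈ Finset.range n, α k) atTop atTop)
    (hαA : Summable fun k => α k ^ 2 * A) (hασ : Summable fun k => α k ^ 2 * σ k ^ 2)
    (hstep : ∀ᶠ k in atTop, h (k + 1) ≤ h k - c * α k * a k + C * α k * n k)
    (hnoise : ∀ᶠ k in atTop, n (k + 1) ≤ (1 - α k) * n k + α k ^ 2 * s k)
    (hsle : ∀ k, s k ≤ σ k ^ 2 + A * (C' * (h k + n k))) :
    (Summable fun k => α k ^ 2 * s k) ∧ (Summable fun k => α k * n k) ∧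
      Tendsto n atTop (𝓝 0) := by
  obtain ⟨⟨l, hl⟩, hsum⟩ := exists_tendsto_and_summable_of_le_one_add_mul
    -- With weight `C + 1`, the damping of `n` pays for the term `C α n` in the merit inequality and
    -- leaves `α n` as a decrement.
    (a := fun k => h k + (C + 1) * n k) (b := fun k => α k * n k)
    (p := fun k => (C + 1) * C' * (α k ^ 2 * A)) (q := fun k => (C + 1) * (α k ^ 2 * σ k ^ 2))
    (fun k => add_nonneg (hh k) (mul_nonneg (by linarith) (hn k)))
    (fun k => mul_nonneg (hα k).le (hn k)) (fun k => by positivity) (fun k => by positivity)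
    (hαA.mul_left _) (hασ.mul_left _) (by
      filter_upwards [hstep, hnoise] with k h1 h2
      have h3 : s k ≤ σ k ^ 2 + A * (C' * (h k + (C + 1) * n k)) := by
        refine (hsle k).trans ?_
        have := mul_nonneg hC.le (hn k)
        gcongr
        linarith
      have h4 : 0 ≤ c * α k * a k := mul_nonneg (mul_nonneg hc.le (hα k).le) (ha k)
      have h5 : (C + 1) * n (k + 1) ≤ (C + 1) * ((1 - α k) * n k + α k ^ 2 * s k) := by gcongr
      have h6 : (C + 1) * α k ^ 2 * s k
          ≤ (C + 1) * α k ^ 2 * (σ k ^ 2 + A * (C' * (h k + (C + 1) * n k))) := by gcongr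
      linarith)
  obtain ⟨B, hB⟩ := hl.bddAbove_range
  have hB : ∀ k, h k + (C + 1) * n k ≤ B := fun k => hB ⟨k, rfl⟩
  have hssum : Summable fun k => α k ^ 2 * s k := by
    refine Summable.of_nonneg_of_le (fun k => mul_nonneg (sq_nonneg _) (hs k)) (fun k => ?_)
      (hασ.add (hαA.mul_right (C' * B)))
    have h1 : h k + n k ≤ B := by
      have := hB k
      have := mul_nonneg hC.le (hn k)
      linarith
    calc α k ^ 2 * s k ≤ α k ^ 2 * (σ k ^ 2 + A * (C' * B)) := by
          have : A * (C' * (h k + n k)) ≤ A * (C' * B) := by gcongr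
          have := hsle k
          gcongr
          linarith
      _ = _ := by ring
  refine ⟨hssum, hsum, ?_⟩
  obtain ⟨⟨l', hl'⟩, -⟩ := exists_tendsto_and_summable_of_le_sub_add (a := n)
    (b := fun k => α k * n k) hn (fun k => mul_nonneg (hα k).le (hn k)) hssum
    (hnoise.mono fun k hk => by linarith)
  exact tendsto_zero_of_summable_mul hn hα hα_sum hl' hsum

theorem mainTheorem4 {d : ℕ}
    {Ω : Type*} [mΩ : MeasurableSpace Ω] (P : Measure Ω) [IsProbabilityMeasure P]
    (ℱ : Filtration ℕ mΩ)
    -- the composite problem: `ψ = f + φ`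
    (f : EuclideanSpace ℝ (Fin d) → ℝ) (φ : EuclideanSpace ℝ (Fin d) → EReal)
    (hφ : IsProperConvexLSC φ)
    -- `ψ` is bounded from below on the effective domain of `φ`
    (psiBar : ℝ) (hbelow : ∀ y, φ y < ⊤ → (psiBar : EReal) ≤ psi f φ y)
    -- `f` is differentiable and `∇f` is globally Lipschitz continuous
    (hf : Differentiable ℝ f) (L : ℝ≥0) (hL : 0 < L) (hLip : LipschitzWith L (gradient f))
    -- the algorithm
    (lam : ℝ) (hlam : 0 < lam) (z0 : EuclideanSpace ℝ (Fin d))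
    (α : ℕ → ℝ) (hα_pos : ∀ k, 0 < α k)
    (g z x : ℕ → Ω → EuclideanSpace ℝ (Fin d))
    (halg : IsNorMSGD φ lam z0 α g z x)
    (hg_meas : ∀ k, Measurable[ℱ (k + 1)] (g k))
    -- step sizes
    (hα_sum : Tendsto (fun n => ∑ k ∈ Finset.range n, α k) atTop atTop)
    (hα_zero : Tendsto α atTop (𝓝 0))
    -- unbiased gradient estimates, with the conditional second moment bound (the conditional
    -- expectation of the nonnegative variable `‖e k‖²` is taken in `[0, ∞]`)
    (hg_int : ∀ k, Integrable (g k) P)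
    (hg_unbiased : ∀ k, condExp (ℱ k) P (g k) =ᵐ[P] fun ω => gradient f (x k ω))
    (A : ℝ) (hA : 0 ≤ A) (σ : ℕ → ℝ) (hσ : ∀ k, 0 ≤ σ k)
    (hg_var : ∀ k, condLExp (ℱ k) P (fun ω => ‖g k ω - gradient f (x k ω)‖ₑ ^ 2) ≤ᵐ[P]
      fun ω => ENNReal.ofReal (σ k ^ 2 + A * ((psi f φ (x k ω)).toReal - psiBar)))
    (hsummable : Summable fun k => α k ^ 2 * max A (σ k ^ 2)) :
    -- all iterates have a finite objective value
    (∀ k ω, φ (x k ω) < ⊤) ∧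
    -- (a) almost sure convergence
    (∃ psiStar : Ω → ℝ, Measurable psiStar ∧ ∀ᵐ ω ∂P,
      Tendsto (fun k => ‖Fnor f φ lam (z k ω)‖) atTop (𝓝 0) ∧
      Tendsto (fun k => ‖Fnat f φ lam (x k ω)‖) atTop (𝓝 0) ∧
      Tendsto (fun k => (psi f φ (x k ω)).toReal) atTop (𝓝 (psiStar ω))) ∧
    -- (b) convergence in expectation
    ((∀ k, Integrable (fun ω => ‖Fnor f φ lam (z k ω)‖ ^ 2) P) ∧
      Tendsto (fun k => ∫ ω, ‖Fnor f φ lam (z k ω)‖ ^ 2 ∂P) atTop (𝓝 0) ∧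
      (∀ k, Integrable (fun ω => ‖Fnat f φ lam (x k ω)‖ ^ 2) P) ∧
      Tendsto (fun k => ∫ ω, ‖Fnat f φ lam (x k ω)‖ ^ 2 ∂P) atTop (𝓝 0) ∧
      (∀ k, Integrable (fun ω => (psi f φ (x k ω)).toReal) P) ∧
      ∃ rhoStar : ℝ,
        Tendsto (fun k => ∫ ω, (psi f φ (x k ω)).toReal ∂P) atTop (𝓝 rhoStar)) := by
  obtain ⟨hinit, hstep, hprox⟩ := halg
  obtain rfl : x = fun k ω => prox φ lam (z k ω) := funext fun k => funext (hprox k)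
  simp only at hg_unbiased hg_var ⊢
  refine ⟨fun k ω => hφ.prox_lt_top hlam _, ?_⟩
  have hit := iterates_memLp hφ hlam hf hLip hbelow hinit hstep hg_meas hA hg_var
  obtain ⟨κ, c, C, α₀, hκ, hc, hC, hα₀, hα₀1, H⟩ := exists_shifted_step_bounds hφ hlam hf hLip
  set e : ℕ → Ω → EuclideanSpace ℝ (Fin d) :=
    fun k ω => g k ω - gradient f (prox φ lam (z k ω)) with he
  have hem : ∀ k, StronglyMeasurable[ℱ (k + 1)] (e k) := fun k => (hit k).2.2.1
  have heL : ∀ k, MemLp (e k) 2 P := fun k => (hit k).2.2.2.1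
  have hzL : ∀ k, MemLp (z k) 2 P := fun k => (hit k).2.1
  have he0 : ∀ k, P[e k | ℱ k] =ᵐ[P] 0 := fun k => by
    have hGm : StronglyMeasurable[ℱ k] (fun ω => gradient f (prox φ lam (z k ω))) :=
      (hLip.continuous.comp (continuous_prox hφ hlam)).comp_stronglyMeasurable (hit k).1
    have hgi := (hg_int k).sub ((heL k).integrable one_le_two)
    have hGi : Integrable (fun ω => gradient f (prox φ lam (z k ω))) P :=
      hgi.congr (ae_of_all _ fun ω => by simp [he])
    filter_upwards [condExp_sub (hg_int k) hGi (ℱ k), hg_unbiased k] with ω h1 h2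
    refine Eq.trans h1 ?_
    rw [Pi.sub_apply, h2, condExp_of_stronglyMeasurable (ℱ.le k) hGm hGi]
    simp
  -- the filtered noise and the shifted iterates
  set N := filteredNoise α e with hN
  set y : ℕ → Ω → EuclideanSpace ℝ (Fin d) := fun k ω => z k ω - N k ω with hy
  have hyN : ∀ k ω, y k ω + N k ω = z k ω := fun k ω => sub_add_cancel _ _
  have hNL : ∀ k, MemLp (N k) 2 P := fun k => memLp_filteredNoise heL k
  have hyL : ∀ k, MemLp (y k) 2 P := fun k => (hzL k).sub (hNL k)
  have hysucc : ∀ k, α k ≤ 1 → ∀ ω,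
      y (k + 1) ω = y k ω - α k • (Fnor f φ lam (y k ω + N k ω) - N k ω) :=
    fun k hk ω => sub_filteredNoise_succ hstep (fun _ _ => rfl) hk ω
  have hαev : ∀ᶠ k in atTop, α k ≤ α₀ := hα_zero.eventually_le_const hα₀
  have hΨ : ∀ k ω, |(psi f φ (prox φ lam (z k ω))).toReal
      - (psi f φ (prox φ lam (y k ω))).toReal| ≤ C * (‖Fnor f φ lam (y k ω)‖ ^ 2 + ‖N k ω‖ ^ 2) :=
    fun k ω => by simpa only [hyN] using (H (y k ω) (N k ω)).1
  have hF : ∀ k ω, ‖Fnor f φ lam (z k ω)‖ ^ 2 ≤ C * (‖Fnor f φ lam (y k ω)‖ ^ 2 + ‖N k ω‖ ^ 2) :=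
    fun k ω => by simpa only [hyN] using (H (y k ω) (N k ω)).2.1
  have hmer : ∀ᶠ k in atTop, ∀ ω, merit f φ lam κ (y (k + 1) ω) ≤ merit f φ lam κ (y k ω)
      - c * α k * ‖Fnor f φ lam (y k ω)‖ ^ 2 + C * α k * ‖N k ω‖ ^ 2 := by
    filter_upwards [hαev] with k hk ω
    rw [hysucc k (hk.trans hα₀1)]
    exact ((H (y k ω) (N k ω)).2.2 (α k) (hα_pos k) hk).1
  have hres : ∀ᶠ k in atTop, ∀ ω, ‖Fnor f φ lam (y (k + 1) ω)‖ ^ 2 ≤ ‖Fnor f φ lam (y k ω)‖ ^ 2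
      + C * α k * (‖Fnor f φ lam (y k ω)‖ ^ 2 + ‖N k ω‖ ^ 2) := by
    filter_upwards [hαev] with k hk ω
    rw [hysucc k (hk.trans hα₀1)]
    exact ((H (y k ω) (N k ω)).2.2 (α k) (hα_pos k) hk).2
  have hmerlow : ∀ u, psiBar + κ * ‖Fnor f φ lam u‖ ^ 2 ≤ merit f φ lam κ u := fun u => by
    have := le_toReal_psi_prox hφ hlam hbelow u
    rw [merit]; linarith
  have hmerlow' : ∀ u, psiBar ≤ merit f φ lam κ u := fun u =>
    le_trans (by have : 0 ≤ κ * ‖Fnor f φ lam u‖ ^ 2 := by positivity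
                 linarith) (hmerlow u)
  -- integrability
  have hFyi : ∀ k, Integrable (fun ω => ‖Fnor f φ lam (y k ω)‖ ^ 2) P := fun k =>
    integrable_norm_sq_of_memLp_two (memLp_Fnor_comp hφ hlam hLip (hyL k))
  have hFzi : ∀ k, Integrable (fun ω => ‖Fnor f φ lam (z k ω)‖ ^ 2) P := fun k =>
    integrable_norm_sq_of_memLp_two (memLp_Fnor_comp hφ hlam hLip (hzL k))
  have hΨyi : ∀ k, Integrable (fun ω => (psi f φ (prox φ lam (y k ω))).toReal) P := fun k =>
    integrable_toReal_psi_prox hφ hlam hf hLip (hyL k)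
  have hΨzi : ∀ k, Integrable (fun ω => (psi f φ (prox φ lam (z k ω))).toReal) P := fun k =>
    integrable_toReal_psi_prox hφ hlam hf hLip (hzL k)
  have hNi : ∀ k, Integrable (fun ω => ‖N k ω‖ ^ 2) P := fun k =>
    integrable_norm_sq_of_memLp_two (hNL k)
  have hmeri : ∀ k, Integrable (fun ω => merit f φ lam κ (y k ω)) P := fun k =>
    (hΨyi k).add ((hFyi k).const_mul κ)
  have hFnat : ∀ k ω, ‖Fnat f φ lam (prox φ lam (z k ω))‖ ^ 2
      ≤ lam ^ 2 * ‖Fnor f φ lam (z k ω)‖ ^ 2 := fun k ω => by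
    rw [← mul_pow]
    exact pow_le_pow_left₀ (norm_nonneg _) (hφ.norm_Fnat_prox_le hlam f (z k ω)) 2
  have hFnati : ∀ k, Integrable (fun ω => ‖Fnat f φ lam (prox φ lam (z k ω))‖ ^ 2) P := fun k =>
    ((hFzi k).const_mul (lam ^ 2)).mono'
      ((((continuous_Fnat hφ hlam hLip).comp
        (continuous_prox hφ hlam)).comp_aestronglyMeasurable (hzL k).1).norm.pow 2)
      (ae_of_all _ fun ω => by
        rw [Real.norm_of_nonneg (sq_nonneg _)]; exact hFnat k ω)
  -- sequences of expectations
  set hE : ℕ → ℝ := fun k => ∫ ω, merit f φ lam κ (y k ω) ∂P with hhE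
  set aE : ℕ → ℝ := fun k => ∫ ω, ‖Fnor f φ lam (y k ω)‖ ^ 2 ∂P with haE
  set nE : ℕ → ℝ := fun k => ∫ ω, ‖N k ω‖ ^ 2 ∂P with hnE
  have hhE0 : ∀ k, psiBar ≤ hE k := fun k => by
    have := integral_mono (integrable_const psiBar) (hmeri k) fun ω => hmerlow' (y k ω)
    simpa using this
  have haE0 : ∀ k, 0 ≤ aE k := fun k => integral_nonneg fun _ => sq_nonneg _
  have hnE0 : ∀ k, 0 ≤ nE k := fun k => integral_nonneg fun _ => sq_nonneg _
  have hCi : ∀ k, ∫ ω, C * (‖Fnor f φ lam (y k ω)‖ ^ 2 + ‖N k ω‖ ^ 2) ∂P = C * (aE k + nE k) :=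
    fun k => by rw [integral_const_mul, integral_add (hFyi k) (hNi k)]
  have hCint : ∀ k, Integrable
      (fun ω => C * (‖Fnor f φ lam (y k ω)‖ ^ 2 + ‖N k ω‖ ^ 2)) P := fun k =>
    ((hFyi k).add (hNi k)).const_mul C
  have hstepE : ∀ᶠ k in atTop, hE (k + 1) ≤ hE k - c * α k * aE k + C * α k * nE k := by
    filter_upwards [hmer] with k hk
    have h1 := (hFyi k).const_mul (c * α k)
    have h2 := (hNi k).const_mul (C * α k)
    have h3 : Integrable (fun ω => merit f φ lam κ (y k ω)
      - c * α k * ‖Fnor f φ lam (y k ω)‖ ^ 2) P := (hmeri k).sub h1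
    refine (integral_mono (hmeri (k + 1)) (h3.add h2) hk).trans_eq ?_
    simp only [Pi.add_apply]
    rw [integral_add h3 h2, integral_sub (hmeri k) h1, integral_const_mul, integral_const_mul]
  have hresE : ∀ᶠ k in atTop, aE (k + 1) ≤ aE k + C * α k * (aE k + nE k) := by
    filter_upwards [hres] with k hk
    have h1 : Integrable (fun ω => C * α k * (‖Fnor f φ lam (y k ω)‖ ^ 2 + ‖N k ω‖ ^ 2)) P :=
      ((hFyi k).add (hNi k)).const_mul _
    refine (integral_mono (hFyi (k + 1)) ((hFyi k).add h1) hk).trans_eq ?_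
    simp only [Pi.add_apply]
    rw [integral_add (hFyi k) h1, integral_const_mul, integral_add (hFyi k) (hNi k)]
  have hnoiseE : ∀ᶠ k in atTop, nE (k + 1) ≤ (1 - α k) * nE k
      + α k ^ 2 * ∫ ω, ‖e k ω‖ ^ 2 ∂P := by
    filter_upwards [hαev] with k hk
    have := integral_norm_sq_filteredNoise_succ_le (P := P) hα_pos hem heL he0 k
    rwa [min_eq_left (hk.trans hα₀1)] at this
  have herrE : ∀ k, ∫ ω, ‖e k ω‖ ^ 2 ∂P ≤
      -- The shift from `z` to `y` costs `C (‖F_nor(y)‖² + ‖N‖²)`, and `κ ‖F_nor(y)‖²` is at most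
      -- the merit excess over `psiBar`, whence `C / κ`.
      σ k ^ 2 + A * ((1 + C + C / κ) * ((hE k - psiBar) + nE k)) := fun k => by
    refine (hit k).2.2.2.2.trans ?_
    gcongr
    have h1 : ∀ ω, (psi f φ (prox φ lam (z k ω))).toReal - psiBar ≤
        (1 + C + C / κ) * ((merit f φ lam κ (y k ω) - psiBar) + ‖N k ω‖ ^ 2) := fun ω => by
      have g1 := (abs_le.1 (hΨ k ω)).2
      have g2 := hmerlow (y k ω)
      have g3 : C / κ * (κ * ‖Fnor f φ lam (y k ω)‖ ^ 2)
          ≤ C / κ * (merit f φ lam κ (y k ω) - psiBar) := by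
        gcongr
        linarith
      have g4 : C / κ * (κ * ‖Fnor f φ lam (y k ω)‖ ^ 2) = C * ‖Fnor f φ lam (y k ω)‖ ^ 2 := by
        field_simp
      have g5 : (psi f φ (prox φ lam (y k ω))).toReal ≤ merit f φ lam κ (y k ω) := by
        rw [merit]
        have : 0 ≤ κ * ‖Fnor f φ lam (y k ω)‖ ^ 2 := by positivity
        linarith
      have g6 : 0 ≤ C * (merit f φ lam κ (y k ω) - psiBar) :=
        mul_nonneg hC.le (sub_nonneg.2 (hmerlow' _))
      have g7 : 0 ≤ (1 + C / κ) * ‖N k ω‖ ^ 2 := by positivity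
      linarith
    have h2 : Integrable (fun ω => merit f φ lam κ (y k ω) - psiBar) P :=
      (hmeri k).sub (integrable_const _)
    refine (integral_mono ((hΨzi k).sub (integrable_const _)) ((h2.add (hNi k)).const_mul _)
      h1).trans_eq ?_
    simp only [Pi.add_apply]
    rw [integral_const_mul, integral_add h2 (hNi k),
      integral_sub (hmeri k) (integrable_const _)]
    simp [hhE, hnE]
  have hαA : Summable fun k => α k ^ 2 * A := hsummable.of_nonneg_of_le
    (fun k => by positivity) fun k => by gcongr; exact le_max_left _ _
  have hασ : Summable fun k => α k ^ 2 * σ k ^ 2 := hsummable.of_nonneg_of_le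
    (fun k => by positivity) fun k => by gcongr; exact le_max_right _ _
  obtain ⟨hesum, hnsum, hn0⟩ := noise_energy_bounds (h := fun k => hE k - psiBar) hc hC hA
    (by positivity) (fun k => sub_nonneg.2 (hhE0 k)) haE0 hnE0
    (fun k => integral_nonneg fun _ => sq_nonneg _) hα_pos hα_sum hαA hασ
    (hstepE.mono fun k hk => by linarith) hnoiseE herrE
  constructor
  · -- almost sure convergence
    have hNsum : ∀ᵐ ω ∂P, Summable fun k => α k * ‖N k ω‖ ^ 2 :=
      ae_summable_of_summable_integral
        (fun k ω => mul_nonneg (hα_pos k).le (sq_nonneg _)) (fun k => (hNi k).const_mul _)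
        (by simpa only [integral_const_mul] using hnsum)
    obtain ⟨B, hB⟩ := hn0.bddAbove_range
    have hN0 := ae_tendsto_filteredNoise hα_pos hα_sum hem heL he0 hesum
      (fun k => hB ⟨k, rfl⟩) hNsum
    have hconv : ∀ᵐ ω ∂P, Tendsto (fun k => ‖Fnor f φ lam (z k ω)‖ ^ 2) atTop (𝓝 0) ∧
        ∃ l, Tendsto (fun k => (psi f φ (prox φ lam (z k ω))).toReal) atTop (𝓝 l) := by
      filter_upwards [hNsum, hN0] with ω h1 h2
      refine tendsto_of_descent (h := fun k => merit f φ lam κ (y k ω))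
        (a := fun k => ‖Fnor f φ lam (y k ω)‖ ^ 2) (n := fun k => ‖N k ω‖ ^ 2) (κ := κ) hc
        (fun k => hmerlow' _) (fun k => sq_nonneg _) (fun k => sq_nonneg _) hα_pos hα_sum
        (hmer.mono fun k hk => hk ω) (hres.mono fun k hk => hk ω) (fun k => hF k ω)
        (fun k => ?_) h1 h2
      rw [merit, add_sub_cancel_right]
      exact hΨ k ω
    -- The pointwise limits need not be chosen measurably, so a measurable version is taken.
    obtain ⟨psiStar, hmeas, hlim⟩ := measurable_limit_of_tendsto_metrizable_ae
      (fun k => (hΨzi k).1.aemeasurable) (hconv.mono fun ω h => h.2)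
    refine ⟨psiStar, hmeas, ?_⟩
    filter_upwards [hconv, hlim] with ω h1 h2
    have h3 : Tendsto (fun k => ‖Fnor f φ lam (z k ω)‖) atTop (𝓝 0) := by
      have := h1.1.sqrt
      simpa only [Real.sqrt_sq (norm_nonneg _), Real.sqrt_zero] using this
    refine ⟨h3, squeeze_zero (fun _ => norm_nonneg _)
      (fun k => hφ.norm_Fnat_prox_le hlam f (z k ω)) ?_, h2⟩
    simpa using h3.const_mul lam
  · -- convergence in expectation
    obtain ⟨h1, h2⟩ := tendsto_of_descent (h := hE) (a := aE) (n := nE) (κ := κ)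
      (r := fun k => ∫ ω, ‖Fnor f φ lam (z k ω)‖ ^ 2 ∂P)
      (s := fun k => ∫ ω, (psi f φ (prox φ lam (z k ω))).toReal ∂P) hc hhE0 haE0
      (fun k => integral_nonneg fun _ => sq_nonneg _) hα_pos hα_sum hstepE hresE
      (fun k => (integral_mono (hFzi k) (hCint k) (hF k)).trans_eq (hCi k))
      (fun k => by
        have g1 : hE k - κ * aE k = ∫ ω, (psi f φ (prox φ lam (y k ω))).toReal ∂P := by
          simp only [hhE, haE, merit]
          rw [integral_add (hΨyi k) ((hFyi k).const_mul κ), integral_const_mul]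
          ring
        rw [g1, ← integral_sub (hΨzi k) (hΨyi k), ← hCi k, ← Real.norm_eq_abs]
        exact norm_integral_le_of_norm_le (hCint k) (ae_of_all _ fun ω => hΨ k ω)) hnsum hn0
    refine ⟨hFzi, h1, hFnati, ?_, hΨzi, h2⟩
    refine squeeze_zero (fun k => integral_nonneg fun _ => sq_nonneg _)
      (fun k => (integral_mono (hFnati k) ((hFzi k).const_mul (lam ^ 2)) (hFnat k)).trans_eq
        (integral_const_mul _ _)) ?_
    simpa using h1.const_mul (lam ^ 2)
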